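/- Let $n$ be a positive integer, $2<p\le\infty$ and $0<s\le\infty$. Let $\Gamma\subset\mathbb R^n$ be a regular open convex cone, that is, a nonempty open set with $0\notin\Gamma$ and $\alpha x+\beta y\in\Gamma$ for all $x,y\in\Gamma$, $\alpha,\beta>0$, whose dual cone $\Gamma^*=\{y\in\mathbb R^n: y\cdot x\ge 0\text{ for all }x\in\Gamma\}$ has nonempty interior. Let $\psi:\Gamma\to\mathbb R$ be continuous with $$R_\psi=\limsup_{y\in\Gamma,\,|y|\to\infty}\frac{\psi(y)}{|y|}<\infty .$$ Let $T_\Gamma=\mathbb R^n+i\Gamma\subset\mathbb C^n$, and let $A^{p,s}(\Gamma,\psi)$ be the space of holomorphic functions $F$ on $T_\Gamma$ with $\|F\|_{A^{p,s}(\Gamma,\psi)}<\infty$, where $$\|F\|_{A^{p,s}(\Gamma,\psi)}=\left(\int_{\Gamma}\left(\int_{\mathbb R^n}|F(x+iy)e^{-2\pi\psi(y)}|^p\,dx\right)^s dy\right)^{\frac1{sp}}\quad(p,s<\infty),$$ $$\|F\|_{A^{p,\infty}(\Gamma,\psi)}=\sup_{y\in\Gamma}e^{-2\pi\psi(y)}\left(\int_{\mathbb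 R^n}|F(x+iy)|^p\,dx\right)^{\frac1p}\quad(p<\infty,\ s=\infty),$$ $$\|F\|_{A^{\infty,s}(\Gamma,\psi)}=\sup_{x\in\mathbb R^n,\,y\in\Gamma}e^{-2\pi\psi(y)}|F(x+iy)|\quad(p=\infty,\ \text{whatever } s).$$ For $0<\alpha<\infty$ put $$U_\alpha(\Gamma,\psi)=\left\{t\in\mathbb R^n:\int_\Gamma e^{-2\pi\alpha(t\cdot y+\psi(y))}\,dy<\infty\right\},\qquad U_\infty(\Gamma,\psi)=\left\{t\in\mathbb R^n:\inf_{y\in\Gamma}(y\cdot t+\psi(y))>-\infty\right\},$$ with $sp=\infty$ if $s=\infty$ or $p=\infty$. If $F\in A^{p,s}(\Gamma,\psi)$ satisfies $$\liminf_{y\in\Gamma,\,y\to0}\int_{\mathbb R^n}|F(x+iy)|^2\,dx<\infty,$$ then there exists $f\in L^2(\mathbb R^n)$, vanishing outside $U_{sp}(\Gamma,\psi)$, such that for every $z\in T_\Gamma$ the function $t\mapsto f(t)e^{2\pi i t\cdot z}$ is integrable on $\mathbb R^n$ and $$F(z)=\int_{\mathbb R^n}f(t)e^{2\pi i t\cdot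 z}\,dt,\qquad t\cdot z=\sum_{j=1}^n t_jz_j .$$ -/

import Mathlib

open MeasureTheory Filter Topology
open scoped ENNReal

noncomputable section

namespace TubeBergman

/-- The dual cone `Γ* = {y : y · x ≥ 0 for all x ∈ Γ}`. -/
def dualCone {n : ℕ} (Γ : Set (EuclideanSpace ℝ (Fin n))) : Set (EuclideanSpace ℝ (Fin n)) :=
  {y | ∀ x ∈ Γ, 0 ≤ inner ℝ y x}

/-- Regular open convex cones: nonempty open sets that do not contain `0`, are closed under
combinations with positive coefficients, and whose dual cone has nonempty interior. -/
structure IsRegularOpenConvexCone {n : ℕ} (Γ : Set (EuclideanSpace ℝ (Fin n))) : Prop where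
  nonempty : Γ.Nonempty
  isOpen : IsOpen Γ
  zero_notMem : (0 : EuclideanSpace ℝ (Fin n)) ∉ Γ
  combo_mem : ∀ x ∈ Γ, ∀ y ∈ Γ, ∀ a b : ℝ, 0 < a → 0 < b → a • x + b • y ∈ Γ
  regular : (interior (dualCone Γ)).Nonempty

/-- The point `x + i y` of `ℂⁿ`. -/
def cpoint {n : ℕ} (x y : EuclideanSpace ℝ (Fin n)) : EuclideanSpace ℂ (Fin n) :=
  WithLp.toLp 2 (fun j => (x j : ℂ) + (y j : ℂ) * Complex.I)

/-- The tube `T_B = ℝⁿ + i B`. -/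
def tube {n : ℕ} (B : Set (EuclideanSpace ℝ (Fin n))) : Set (EuclideanSpace ℂ (Fin n)) :=
  {z | ∃ x : EuclideanSpace ℝ (Fin n), ∃ y ∈ B, z = cpoint x y}

/-- The norm of `A^{p,s}(B,ψ)`, with values in `[0,∞]`, for `0 < p ≤ ∞` and `0 < s ≤ ∞`.
For `p = ∞` it is the weighted supremum over the tube. -/
def weightedNorm {n : ℕ} (p s : ℝ≥0∞) (B : Set (EuclideanSpace ℝ (Fin n)))
    (ψ : EuclideanSpace ℝ (Fin n) → ℝ) (F : EuclideanSpace ℂ (Fin n) → ℂ) : ℝ≥0∞ :=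
  if p = ∞ then
    ⨆ y ∈ B, ⨆ x : EuclideanSpace ℝ (Fin n),
      ENNReal.ofReal (Real.exp (-2 * Real.pi * ψ y)) * ‖F (cpoint x y)‖ₑ
  else if s = ∞ then
    ⨆ y ∈ B, ENNReal.ofReal (Real.exp (-2 * Real.pi * ψ y)) *
      (∫⁻ x : EuclideanSpace ℝ (Fin n), ‖F (cpoint x y)‖ₑ ^ p.toReal) ^ (1 / p.toReal)
  else
    (∫⁻ y in B, (∫⁻ x : EuclideanSpace ℝ (Fin n),
      (‖F (cpoint x y)‖ₑ * ENNReal.ofReal (Real.exp (-2 * Real.pi * ψ y))) ^ p.toReal)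
        ^ s.toReal) ^ (1 / (s.toReal * p.toReal))

/-- The space `A^{p,s}(B,ψ)`: holomorphic functions on the tube over `B` of finite norm. -/
def weightedBergman {n : ℕ} (p s : ℝ≥0∞) (B : Set (EuclideanSpace ℝ (Fin n)))
    (ψ : EuclideanSpace ℝ (Fin n) → ℝ) : Set (EuclideanSpace ℂ (Fin n) → ℂ) :=
  {F | DifferentiableOn ℂ F (tube B) ∧ weightedNorm p s B ψ F < ∞}

/-- The set `U_α(B,ψ)`, for `0 < α ≤ ∞`. -/
def supportSet {n : ℕ} (α : ℝ≥0∞) (B : Set (EuclideanSpace ℝ (Fin n)))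
    (ψ : EuclideanSpace ℝ (Fin n) → ℝ) : Set (EuclideanSpace ℝ (Fin n)) :=
  {t | if α = ∞ then BddBelow ((fun y => inner ℝ y t + ψ y) '' B)
    else ∫⁻ y in B,
      ENNReal.ofReal (Real.exp (-2 * Real.pi * α.toReal * (inner ℝ t y + ψ y))) < ∞}

/-- `R_ψ`, the upper limit of `ψ(y)/|y|` as `y ∈ Γ` tends to infinity, in `[-∞,∞]`. -/
def growthRate {n : ℕ} (Γ : Set (EuclideanSpace ℝ (Fin n)))
    (ψ : EuclideanSpace ℝ (Fin n) → ℝ) : EReal :=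
  limsup (fun y => ((ψ y / ‖y‖ : ℝ) : EReal)) (Bornology.cobounded _ ⊓ 𝓟 Γ)

/-- The kernel `e^{2π i t · z}`, where `t · z = ∑ t_j z_j`. -/
def laplaceKernel {n : ℕ} (t : EuclideanSpace ℝ (Fin n)) (z : EuclideanSpace ℂ (Fin n)) : ℂ :=
  Complex.exp (2 * Real.pi * Complex.I * ∑ j, (t j : ℂ) * z j)

end TubeBergman

end

/-! For a test function φ put Φ(z) = ∫ φ(t) e^{-2πi t·z} dt, an entire function that decreases
rapidly on horizontal slices. If F is to be represented by f, then ∫ F(x+iy) Φ(x+iy) dx = ∫ f φ for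
every y in Γ; the proof uses this identity to construct f. A sub-mean value inequality for |F|^q
with q ≤ 1 bounds F on slices, locally uniformly in y (`forall_exists_bound`). Hence the left side
Λ(φ) makes sense, and it does not depend on y (`integral_mul_fourierLaplace_eq`). Letting y → 0
along slices of bounded L² norm, Cauchy–Schwarz and Plancherel give |Λ(φ)| ≤ C‖φ‖₂, so Λ has a
square integrable density (`exists_density`).

The support comes from Hölder's inequality on a slice. If Λ(φ) ≠ 0 and τ·y ≤ t·y for all τ in supp φ
and y in Γ, then e^{-2π(t·y+ψ(y))} is at most a constant times the weighted L^p norm of the slice at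
y, whence t ∈ U_{sp} (`mem_supportSet_of_integral_ne_zero`). When supp φ lies in a small ball about
t₀, such a t is found by moving t₀ slightly in a direction interior to the dual cone. So f vanishes
almost everywhere off the closure of U_{sp}, and the frontier of that convex set is null.

Finally R_ψ < ∞ forces t·v ≥ -A|v| on Γ for t in U_{sp}. Since Γ is open, e^{-2πt·y} then decays
exponentially on the support of f, the products are integrable, and Fourier inversion on each slice
recovers F. -/

namespace TubeBergman

/-! ### Sub-mean value inequalities for powers of holomorphic functions -/

section SubMean

variable {V : Type*} [NormedAddCommGroup V] [NormedSpace ℂ V] [FiniteDimensional ℂ V]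
  [MeasurableSpace V] [BorelSpace V] (μ : Measure V) [μ.IsAddHaarMeasure]

/-- A Haar measure on a complex vector space is invariant under multiplication by unimodular
scalars. -/
theorem measurePreserving_unit_smul {c : ℂ} (hc : ‖c‖ = 1) :
    MeasurePreserving (fun x : V => c • x) μ μ := by
  have : FiniteDimensional ℝ V := FiniteDimensional.complexToReal V
  have hc0 : c ≠ 0 := by rintro rfl; simp at hc
  have hme : Measurable (fun x : V => c • x) := (continuous_const_smul c).measurable
  have hH : (μ.map (fun x : V => c • x)).IsAddHaarMeasure := by
    exact (DistribMulAction.toAddEquiv V (Units.mk0 c hc0)).isAddHaarMeasure_map μ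
      (continuous_const_smul c) (continuous_const_smul c⁻¹)
  have h1 := Measure.isAddLeftInvariant_eq_smul (μ.map (fun x : V => c • x)) μ
  refine ⟨hme, ?_⟩
  -- The image measure is a multiple of μ. The closed unit ball is invariant and has finite positive
  -- measure, which forces the factor to be 1.
  have h2 : (μ.map (fun x : V => c • x)) (Metric.closedBall 0 1) = μ (Metric.closedBall 0 1) := by
    rw [Measure.map_apply hme measurableSet_closedBall]
    congr 1
    ext x
    simp [norm_smul, hc]
  set k := Measure.addHaarScalarFactor (μ.map (fun x : V => c • x)) μ
  rw [h1] at h2 ⊢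
  have h3 : (k : ℝ≥0∞) = 1 := by
    have hpos : μ (Metric.closedBall 0 1) ≠ 0 :=
      (Metric.measure_closedBall_pos μ 0 one_pos).ne'
    have hfin : μ (Metric.closedBall (0:V) 1) ≠ ∞ := measure_closedBall_lt_top.ne
    have h4 : (k : ℝ≥0∞) * μ (Metric.closedBall 0 1) = 1 * μ (Metric.closedBall 0 1) := by
      rw [one_mul]; exact h2
    exact (ENNReal.mul_left_inj hpos hfin).1 h4
  have : k = 1 := by exact_mod_cast h3
  rw [this, one_smul]

theorem enorm_le_lintegral_circle {f : ℂ → ℂ} {U : Set ℂ}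
    (hUb : Metric.closedBall 0 1 ⊆ U) (hf : DifferentiableOn ℂ f U) :
    ENNReal.ofReal (2 * Real.pi) * ‖f 0‖ₑ ≤
      ∫⁻ θ in Set.Ioc 0 (2 * Real.pi), ‖f (circleMap 0 1 θ)‖ₑ := by
  have h1 : DiffContOnCl ℂ f (Metric.ball 0 |1|) := by
    apply DifferentiableOn.diffContOnCl
    rw [closure_ball _ (by simp)]
    exact hf.mono (by simpa using hUb)
  have h2 := h1.circleAverage
  rw [Real.circleAverage_def, intervalIntegral.integral_of_le Real.two_pi_pos.le] at h2
  rw [← h2, enorm_smul, ← mul_assoc]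
  have : ENNReal.ofReal (2 * Real.pi) * ‖(2 * Real.pi)⁻¹‖ₑ = 1 := by
    rw [Real.enorm_of_nonneg (by positivity), ← ENNReal.ofReal_mul (by positivity),
      mul_inv_cancel₀ (by positivity), ENNReal.ofReal_one]
  rw [this, one_mul]
  exact enorm_integral_le_lintegral_enorm _

/-- The sub-mean value property of the modulus of a holomorphic function on balls. -/
theorem enorm_mul_measure_ball_le {F : V → ℂ} {w : V} {ρ : ℝ}
    (hF : DifferentiableOn ℂ F (Metric.ball w ρ)) :
    ‖F w‖ₑ * μ (Metric.ball w ρ) ≤ ∫⁻ z in Metric.ball w ρ, ‖F z‖ₑ ∂μ := by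
  have : FiniteDimensional ℝ V := FiniteDimensional.complexToReal V
  set G : V → ℝ≥0∞ := (Metric.ball (0:V) ρ).indicator (fun u => ‖F (w + u)‖ₑ) with hG
  have hmap : Set.MapsTo (fun u => w + u) (Metric.ball (0:V) ρ) (Metric.ball w ρ) := by
    intro u hu; simpa using hu
  have hGm : Measurable G := by
    have hc : ContinuousOn (fun u => ‖F (w + u)‖ₑ) (Metric.ball (0:V) ρ) :=
      (hF.continuousOn.comp (by fun_prop) hmap).enorm
    classical
    rw [hG, ← Set.piecewise_eq_indicator]
    exact hc.measurable_piecewise continuousOn_const measurableSet_ball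
  have hR : ∫⁻ z in Metric.ball w ρ, ‖F z‖ₑ ∂μ = ∫⁻ u, G u ∂μ := by
    rw [← lintegral_indicator measurableSet_ball, ← lintegral_add_left_eq_self _ w]
    congr 1; ext u
    simp only [hG, Set.indicator]
    simp
  -- Rotation by e^{iθ} replaces polar coordinates: the one-variable mean value inequality on each
  -- disc ζ ↦ w + ζu is integrated over u, and Fubini with this invariance removes θ.
  have hrot : ∀ θ : ℝ, ∫⁻ u, G (circleMap 0 1 θ • u) ∂μ = ∫⁻ u, G u ∂μ := fun θ =>
    (measurePreserving_unit_smul μ (c := circleMap 0 1 θ) (by simp)).lintegral_comp hGm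
  have hpt : ∀ u ∈ Metric.ball (0:V) ρ, ENNReal.ofReal (2 * Real.pi) * ‖F w‖ₑ ≤
      ∫⁻ θ in Set.Ioc 0 (2 * Real.pi), G (circleMap 0 1 θ • u) := by
    intro u hu
    have hd : DifferentiableOn ℂ (fun ζ : ℂ => F (w + ζ • u))
        ((fun ζ : ℂ => w + ζ • u) ⁻¹' Metric.ball w ρ) :=
      hF.comp (by fun_prop) (fun _ h => h)
    have h := enorm_le_lintegral_circle ?_ hd
    · simp only [zero_smul, add_zero] at h
      refine h.trans (le_of_eq ?_)
      congr 1; ext θ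
      have : circleMap 0 1 θ • u ∈ Metric.ball (0:V) ρ := by
        simpa [norm_smul] using hu
      simp [hG, this]
    · intro ζ hζ
      simp only [Set.mem_preimage, Metric.mem_ball, dist_self_add_left, norm_smul]
      have h1 : ‖ζ‖ ≤ 1 := by simpa using hζ
      have h2 : ‖u‖ < ρ := by simpa using hu
      nlinarith [norm_nonneg u]
  have hpi : ENNReal.ofReal (2 * Real.pi) ≠ 0 := by simp [Real.pi_pos]
  rw [hR, ← ENNReal.mul_le_mul_iff_right hpi ENNReal.ofReal_ne_top]
  calc ENNReal.ofReal (2 * Real.pi) * (‖F w‖ₑ * μ (Metric.ball w ρ))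
      = ∫⁻ u in Metric.ball (0:V) ρ, ENNReal.ofReal (2 * Real.pi) * ‖F w‖ₑ ∂μ := by
        rw [setLIntegral_const, Measure.addHaar_ball_center, mul_assoc]
    _ ≤ ∫⁻ u in Metric.ball (0:V) ρ,
          ∫⁻ θ in Set.Ioc 0 (2 * Real.pi), G (circleMap 0 1 θ • u) ∂volume ∂μ :=
        setLIntegral_mono' measurableSet_ball hpt
    _ ≤ ∫⁻ u, ∫⁻ θ in Set.Ioc 0 (2 * Real.pi), G (circleMap 0 1 θ • u) ∂volume ∂μ :=
        setLIntegral_le_lintegral _ _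
    _ = ∫⁻ θ in Set.Ioc 0 (2 * Real.pi), ∫⁻ u, G (circleMap 0 1 θ • u) ∂μ := by
        refine lintegral_lintegral_swap (Measurable.aemeasurable ?_)
        refine hGm.comp (Continuous.measurable ?_)
        fun_prop
    _ = ENNReal.ofReal (2 * Real.pi) * ∫⁻ u, G u ∂μ := by
        simp only [hrot]
        rw [setLIntegral_const, mul_comm]
        simp

/-- The local bound of `|F|^q` by its mean, for holomorphic `F` and `0 < q ≤ 1`. -/
theorem exists_enorm_rpow_le_lintegral {q r : ℝ} (hq : 0 < q) (hq1 : q ≤ 1) (hr : 0 < r) :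
    ∃ C : ℝ≥0∞, C ≠ ∞ ∧ ∀ (F : V → ℂ) (z : V) (U : Set V), Metric.closedBall z r ⊆ U →
      DifferentiableOn ℂ F U →
      ‖F z‖ₑ ^ q ≤ C * ∫⁻ u in Metric.ball z r, ‖F u‖ₑ ^ q ∂μ := by
  have : FiniteDimensional ℝ V := FiniteDimensional.complexToReal V
  have : ProperSpace V := FiniteDimensional.proper ℝ V
  set d := Module.finrank ℝ V with hd
  -- This exponent makes (ρ^a)^q = ρ^d, the scaling of the volume of a ball of radius ρ.
  set a : ℝ := d / q with ha
  have ha0 : 0 ≤ a := by positivity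
  have hbpos : 0 < μ (Metric.ball (0:V) 1) := Metric.measure_ball_pos μ 0 one_pos
  have hbfin : μ (Metric.ball (0:V) 1) ≠ ∞ := measure_ball_lt_top.ne
  set b : ℝ := (μ (Metric.ball (0:V) 1)).toReal with hb
  have hb0 : 0 < b := ENNReal.toReal_pos hbpos.ne' hbfin
  refine ⟨ENNReal.ofReal ((r ^ a)⁻¹ ^ q * (2 ^ a * b⁻¹)), ENNReal.ofReal_ne_top, ?_⟩
  intro F z U hBU hF
  set I := ∫⁻ u in Metric.ball z r, ‖F u‖ₑ ^ q ∂μ with hI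
  have hcont : ContinuousOn F (Metric.closedBall z r) := hF.continuousOn.mono hBU
  have hIfin : I ≠ ∞ := by
    obtain ⟨M, hM⟩ := (isCompact_closedBall z r).exists_bound_of_continuousOn hcont
    refine ne_top_of_le_ne_top (b := ∫⁻ u in Metric.ball z r, ENNReal.ofReal M ^ q ∂μ) ?_ ?_
    · rw [setLIntegral_const]
      exact ENNReal.mul_ne_top (ENNReal.rpow_ne_top_of_nonneg hq.le ENNReal.ofReal_ne_top)
        measure_ball_lt_top.ne
    · refine setLIntegral_mono' measurableSet_ball fun u hu => ?_
      gcongr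
      rw [← ofReal_norm]
      exact ENNReal.ofReal_le_ofReal (hM u (Metric.ball_subset_closedBall hu))
  -- At a maximum point w of this weighted modulus, |F| ≤ S ρ^{-a} on the ball about w of half the
  -- distance to the boundary. Splitting |F| = |F|^{1-q}|F|^q there turns the inequality for |F|
  -- into one for |F|^q, with the powers of ρ cancelling.
  set φ : V → ℝ := fun w => (r - dist w z) ^ a * ‖F w‖ with hφ
  have hφc : ContinuousOn φ (Metric.closedBall z r) := by
    refine ContinuousOn.mul ?_ hcont.norm
    exact (Continuous.rpow_const (by fun_prop) (fun _ => Or.inr ha0)).continuousOn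
  obtain ⟨w, hw, hmax⟩ := (isCompact_closedBall z r).exists_isMaxOn
    ⟨z, Metric.mem_closedBall_self hr.le⟩ hφc
  set S := φ w with hS
  have hzS : r ^ a * ‖F z‖ ≤ S := by
    have := hmax (Metric.mem_closedBall_self hr.le)
    simpa [hφ] using this
  have hra : 0 < r ^ a := by positivity
  have key : S ^ q ≤ 2 ^ a * b⁻¹ * I.toReal := by
    rcases (show (0:ℝ) ≤ S from le_trans (by positivity) hzS).eq_or_lt with h0 | hSpos
    · rw [← h0, Real.zero_rpow hq.ne']; positivity
    -- On the boundary the weight vanishes unless `a = 0`, that is, unless V is trivial; then w = z,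
    -- which contradicts 0 < r.
    rcases eq_or_lt_of_le (show dist w z ≤ r from hw) with hwr | hwr
    · have haz : a = 0 := by
        by_contra haz
        have : S = 0 := by rw [hS, hφ]; simp [hwr, Real.zero_rpow haz]
        linarith
      have hdz : d = 0 := by
        have : (d:ℝ) = 0 := by
          rw [ha, div_eq_zero_iff] at haz
          rcases haz with h | h
          · exact h
          · exact absurd h hq.ne'
        exact_mod_cast this
      have : Subsingleton V := Module.finrank_zero_iff.1 (hd ▸ hdz)
      have : w = z := Subsingleton.elim _ _
      rw [this] at hwr; simp at hwr; linarith
    set ρ := (r - dist w z) / 2 with hρ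
    have hρ0 : 0 < ρ := by rw [hρ]; linarith
    have hsub : Metric.ball w ρ ⊆ Metric.ball z r := by
      apply Metric.ball_subset_ball'
      rw [hρ]; linarith
    have hbd : ∀ u ∈ Metric.ball w ρ, ‖F u‖ ≤ S * (ρ ^ a)⁻¹ := by
      intro u hu
      have h1 : φ u ≤ S := hmax (Metric.ball_subset_closedBall (hsub hu))
      have h2 : ρ ≤ r - dist u z := by
        have h3 := dist_triangle u w z
        have h4 : dist u w < ρ := hu
        rw [hρ] at h4 ⊢; linarith
      rw [← div_eq_mul_inv, le_div_iff₀ (by positivity), mul_comm]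
      refine le_trans ?_ h1
      simp only [hφ]
      gcongr
    have hsm := enorm_mul_measure_ball_le μ
      (hF.mono (hsub.trans (Metric.ball_subset_closedBall.trans hBU)))
    rw [Measure.addHaar_ball_of_pos μ w hρ0] at hsm
    have hle : ∫⁻ u in Metric.ball w ρ, ‖F u‖ₑ ∂μ ≤
        ENNReal.ofReal ((S * (ρ ^ a)⁻¹) ^ (1 - q)) * I := by
      rw [hI, ← lintegral_const_mul' _ _ ENNReal.ofReal_ne_top]
      refine le_trans (setLIntegral_mono' measurableSet_ball ?_)
        (lintegral_mono_set hsub)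
      intro u hu
      have h5 : ‖F u‖ₑ = ‖F u‖ₑ ^ (1 - q) * ‖F u‖ₑ ^ q := by
        rw [← ENNReal.rpow_add_of_nonneg _ _ (by linarith) hq.le]; simp
      conv_lhs => rw [h5]
      gcongr
      rw [← ENNReal.ofReal_rpow_of_nonneg (by positivity) (by linarith)]
      refine ENNReal.rpow_le_rpow ?_ (by linarith)
      rw [← ofReal_norm]
      exact ENNReal.ofReal_le_ofReal (hbd u hu)
    have h6 : ‖F w‖ * (ρ ^ d * b) ≤ (S * (ρ ^ a)⁻¹) ^ (1 - q) * I.toReal := by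
      have h7 := ENNReal.toReal_mono
        (ENNReal.mul_ne_top ENNReal.ofReal_ne_top hIfin) (hsm.trans hle)
      rw [ENNReal.toReal_mul, ENNReal.toReal_mul, ENNReal.toReal_mul, toReal_enorm,
        ENNReal.toReal_ofReal (by positivity), ENNReal.toReal_ofReal (by positivity)] at h7
      exact h7
    have hSw : S = (2 * ρ) ^ a * ‖F w‖ := by
      rw [hS, hφ]; simp only; congr 2; rw [hρ]; ring
    have haq : a * q = d := by rw [ha]; field_simp
    have hd' : ρ ^ d = ρ ^ a * (ρ ^ a) ^ (q - 1) := by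
      rw [← Real.rpow_mul hρ0.le, ← Real.rpow_add hρ0, ← Real.rpow_natCast, ← haq]
      congr 1; ring
    have hSq : S ^ q = S * S ^ (q - 1) := by
      conv_lhs => rw [show q = 1 + (q - 1) by ring, Real.rpow_add hSpos, Real.rpow_one]
    have hneg : ∀ x : ℝ, 0 < x → x ^ (q - 1) * x ^ (1 - q) = 1 := by
      intro x hx
      rw [← Real.rpow_add hx]; simp
    have hρa : 0 < ρ ^ a := by positivity
    rw [Real.mul_rpow hSpos.le (by positivity), Real.inv_rpow hρa.le] at h6
    have h8 : ‖F w‖ * ρ ^ a * b ≤ S ^ (1 - q) * I.toReal := by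
      have e1 := hneg _ hρa
      have p1 : 0 < (ρ ^ a) ^ (1 - q) := by positivity
      rw [hd'] at h6
      have h9 : (‖F w‖ * (ρ ^ a * (ρ ^ a) ^ (q - 1) * b)) * (ρ ^ a) ^ (1 - q) ≤
          (S ^ (1 - q) * ((ρ ^ a) ^ (1 - q))⁻¹ * I.toReal) * (ρ ^ a) ^ (1 - q) := by gcongr
      have e2 : (‖F w‖ * (ρ ^ a * (ρ ^ a) ^ (q - 1) * b)) * (ρ ^ a) ^ (1 - q) =
        ‖F w‖ * ρ ^ a * b := by linear_combination (‖F w‖ * ρ ^ a * b) * e1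
      have e3 : (S ^ (1 - q) * ((ρ ^ a) ^ (1 - q))⁻¹ * I.toReal) * (ρ ^ a) ^ (1 - q) =
        S ^ (1 - q) * I.toReal := by field_simp
      rw [e2, e3] at h9
      exact h9
    rw [hSq]
    have e4 : S * S ^ (q - 1) = 2 ^ a * b⁻¹ * (‖F w‖ * ρ ^ a * b) * S ^ (q - 1) := by
      rw [Real.mul_rpow (by norm_num) hρ0.le] at hSw
      have : S = 2 ^ a * b⁻¹ * (‖F w‖ * ρ ^ a * b) := by rw [hSw]; field_simp
      rw [← this]
    rw [e4]
    calc _ ≤ 2 ^ a * b⁻¹ * (S ^ (1 - q) * I.toReal) * S ^ (q - 1) := by gcongr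
      _ = _ := by linear_combination (2 ^ a * b⁻¹ * I.toReal) * hneg S hSpos
  have hfin : ‖F z‖ ^ q ≤ (r ^ a)⁻¹ ^ q * (2 ^ a * b⁻¹) * I.toReal := by
    have h1 : ‖F z‖ ≤ (r ^ a)⁻¹ * S := by
      rw [inv_mul_eq_div, le_div_iff₀ hra, mul_comm]; exact hzS
    have hS0 : 0 ≤ S := le_trans (by positivity) hzS
    calc ‖F z‖ ^ q ≤ ((r ^ a)⁻¹ * S) ^ q := by gcongr
      _ = (r ^ a)⁻¹ ^ q * S ^ q := Real.mul_rpow (by positivity) hS0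
      _ ≤ (r ^ a)⁻¹ ^ q * (2 ^ a * b⁻¹ * I.toReal) := by gcongr
      _ = _ := by ring
  rw [← ENNReal.ofReal_toReal hIfin, ← ENNReal.ofReal_mul (by positivity),
    ← ofReal_norm, ENNReal.ofReal_rpow_of_nonneg (norm_nonneg _) hq.le]
  exact ENNReal.ofReal_le_ofReal hfin

end SubMean

/-! ### Holomorphic integrals, coordinates on the tube, Fourier–Laplace transforms -/

section

/-- Integrals of locally dominated holomorphic families are holomorphic. -/
theorem differentiableOn_integral_of_dominated {X : Type*} [MeasurableSpace X] {μ : Measure X}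
    {U : Set ℂ} (hU : IsOpen U) {G : ℂ → X → ℂ}
    (hm : ∀ ζ ∈ U, AEStronglyMeasurable (G ζ) μ)
    (hd : ∀ x, DifferentiableOn ℂ (fun ζ => G ζ x) U)
    (hb : ∀ ζ₀ ∈ U, ∃ r > 0, ∃ bound : X → ℝ, Integrable bound μ ∧
      ∀ ζ ∈ Metric.ball ζ₀ r, ζ ∈ U → ∀ x, ‖G ζ x‖ ≤ bound x) :
    DifferentiableOn ℂ (fun ζ => ∫ x, G ζ x ∂μ) U := by
  intro ζ₀ hζ₀
  obtain ⟨r₁, hr₁, bound, hbi, hbd⟩ := hb ζ₀ hζ₀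
  obtain ⟨r₂, hr₂, hsub⟩ := Metric.isOpen_iff.1 hU ζ₀ hζ₀
  set r := min r₁ r₂ with hr
  have hr0 : 0 < r := lt_min hr₁ hr₂
  have hbU : ∀ ζ ∈ Metric.ball ζ₀ r, ζ ∈ U := fun ζ h =>
    hsub (Metric.ball_subset_ball (min_le_right _ _) h)
  have hbb : ∀ ζ ∈ Metric.ball ζ₀ r, ∀ x, ‖G ζ x‖ ≤ bound x := fun ζ h =>
    hbd ζ (Metric.ball_subset_ball (min_le_left _ _) h) (hbU ζ h)
  have hda : ∀ x, ∀ ζ ∈ Metric.ball ζ₀ r, DifferentiableAt ℂ (fun ζ => G ζ x) ζ := fun x ζ h =>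
    (hd x).differentiableAt (hU.mem_nhds (hbU ζ h))
  have hself : ζ₀ ∈ Metric.ball ζ₀ r := Metric.mem_ball_self hr0
  -- The derivative is measurable in x as a limit of difference quotients along a real sequence of
  -- increments smaller than r.
  have hF' : AEStronglyMeasurable (fun x => deriv (fun ζ => G ζ x) ζ₀) μ := by
    set t : ℕ → ℂ := fun k => ((r / 2 / (k + 1) : ℝ) : ℂ) with ht
    have ht0 : ∀ k, t k ≠ 0 := fun k => by
      simp only [ht, ne_eq, Complex.ofReal_eq_zero]; positivity
    have htlim : Tendsto t atTop (𝓝[≠] 0) := by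
      rw [tendsto_nhdsWithin_iff]
      refine ⟨?_, Eventually.of_forall ht0⟩
      have := (tendsto_one_div_add_atTop_nhds_zero_nat (𝕜 := ℝ)).const_mul (r / 2)
      have h2 := (Complex.continuous_ofReal.tendsto _).comp this
      simp only [mul_zero, Complex.ofReal_zero] at h2
      refine h2.congr fun k => ?_
      simp [ht]; ring
    refine aestronglyMeasurable_of_tendsto_ae atTop
      (f := fun k x => (t k)⁻¹ • (G (ζ₀ + t k) x - G ζ₀ x)) (fun k => ?_)
      (ae_of_all _ fun x => ?_)
    · refine ((hm _ (hbU _ ?_)).sub (hm _ hζ₀)).const_smul (t k)⁻¹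
      simp only [Metric.mem_ball, dist_self_add_left, ht, Complex.norm_real, Real.norm_eq_abs]
      rw [abs_of_pos (by positivity), div_lt_iff₀ (by positivity)]
      nlinarith [(Nat.cast_nonneg k : (0:ℝ) ≤ k)]
    · exact (hda x ζ₀ hself).hasDerivAt.tendsto_slope_zero.comp htlim
  refine (hasDerivAt_integral_of_dominated_loc_of_deriv_le (μ := μ) (F := G)
    (F' := fun ζ x => deriv (fun ζ => G ζ x) ζ) (bound := fun x => bound x / (r / 4))
    (Metric.ball_mem_nhds ζ₀ (half_pos hr0)) ?_ ?_ hF' ?_ (hbi.div_const _)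
    ?_).2.differentiableAt.differentiableWithinAt
  · filter_upwards [hU.mem_nhds hζ₀] with ζ h using hm ζ h
  · exact hbi.mono' (hm _ hζ₀) (ae_of_all _ fun x => hbb ζ₀ hself x)
  -- Cauchy's estimate on a disc of radius r/4 about a point of the half ball dominates the
  -- derivative.
  · refine ae_of_all _ fun x ζ hζ => ?_
    have hcb : Metric.closedBall ζ (r / 4) ⊆ Metric.ball ζ₀ r := by
      intro w hw
      have h1 : dist w ζ ≤ r / 4 := hw
      have h2 : dist ζ ζ₀ < r / 2 := hζ
      have h3 := dist_triangle w ζ ζ₀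
      rw [Metric.mem_ball]; linarith
    refine Complex.norm_deriv_le_of_forall_mem_sphere_norm_le (by positivity) ?_ ?_
    · apply DifferentiableOn.diffContOnCl
      rw [closure_ball _ (by positivity)]
      exact fun w hw => (hda x w (hcb hw)).differentiableWithinAt
    · intro w hw
      exact hbb w (hcb (Metric.sphere_subset_closedBall hw)) x
  · refine ae_of_all _ fun x ζ hζ => (hda x ζ ?_).hasDerivAt
    exact Metric.ball_subset_ball (by linarith) hζ

variable {n : ℕ}

theorem cpoint_add_smul (x y v : EuclideanSpace ℝ (Fin n)) (ζ : ℂ) :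
    cpoint x y + ζ • cpoint v 0 = cpoint (x + ζ.re • v) (y + ζ.im • v) := by
  ext j
  apply Complex.ext <;> simp [cpoint]

theorem neg_cpoint (x y : EuclideanSpace ℝ (Fin n)) : -cpoint x y = cpoint (-x) (-y) := by
  ext j
  simp [cpoint]; ring

/-- The imaginary part of a point of `ℂⁿ`. -/
def imPart (z : EuclideanSpace ℂ (Fin n)) : EuclideanSpace ℝ (Fin n) :=
  WithLp.toLp 2 (fun j => (z j).im)

theorem imPart_cpoint (x y : EuclideanSpace ℝ (Fin n)) : imPart (cpoint x y) = y := by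
  ext j; simp [imPart, cpoint]

theorem exists_eq_cpoint (z : EuclideanSpace ℂ (Fin n)) :
    ∃ x : EuclideanSpace ℝ (Fin n), z = cpoint x (imPart z) := by
  refine ⟨WithLp.toLp 2 (fun j => (z j).re), ?_⟩
  ext j
  simp [cpoint, imPart]

theorem continuous_imPart : Continuous (imPart (n := n)) := by
  refine (PiLp.continuous_toLp 2 _).comp ?_
  fun_prop

theorem continuous_cpoint : Continuous fun p : EuclideanSpace ℝ (Fin n) ×
    EuclideanSpace ℝ (Fin n) => cpoint p.1 p.2 := by
  refine (PiLp.continuous_toLp 2 _).comp ?_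
  fun_prop

theorem mem_tube_iff {B : Set (EuclideanSpace ℝ (Fin n))} {z : EuclideanSpace ℂ (Fin n)} :
    z ∈ tube B ↔ imPart z ∈ B := by
  constructor
  · rintro ⟨x, y, hy, rfl⟩
    rwa [imPart_cpoint]
  · intro h
    obtain ⟨x, hx⟩ := exists_eq_cpoint z
    exact ⟨x, _, h, hx⟩

theorem continuous_slice {B : Set (EuclideanSpace ℝ (Fin n))}
    {F : EuclideanSpace ℂ (Fin n) → ℂ} (hF : DifferentiableOn ℂ F (tube B))
    {y : EuclideanSpace ℝ (Fin n)} (hy : y ∈ B) : Continuous fun x => F (cpoint x y) :=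
  hF.continuousOn.comp_continuous
    (continuous_cpoint.comp (continuous_id.prodMk continuous_const)) fun x => ⟨x, y, hy, rfl⟩

theorem differentiableOn_line {B : Set (EuclideanSpace ℝ (Fin n))}
    {F : EuclideanSpace ℂ (Fin n) → ℂ} (hF : DifferentiableOn ℂ F (tube B))
    (x y v : EuclideanSpace ℝ (Fin n)) :
    DifferentiableOn ℂ (fun ζ : ℂ => F (cpoint (x + ζ.re • v) (y + ζ.im • v)))
      {ζ | y + ζ.im • v ∈ B} := by
  simp_rw [← cpoint_add_smul]
  refine hF.comp (by fun_prop) fun ζ hζ => ?_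
  rw [cpoint_add_smul, mem_tube_iff, imPart_cpoint]
  exact hζ

theorem laplaceKernel_cpoint (t x y : EuclideanSpace ℝ (Fin n)) :
    laplaceKernel t (cpoint x y) = Complex.exp (2 * Real.pi * Complex.I * (inner ℝ t x : ℝ)) *
      (Real.exp (-2 * Real.pi * inner ℝ t y) : ℝ) := by
  have : ∑ j, (t j : ℂ) * cpoint x y j =
      (inner ℝ t x : ℝ) + (inner ℝ t y : ℝ) * Complex.I := by
    simp only [PiLp.inner_apply, cpoint, Complex.ofReal_sum, Finset.sum_mul,
      ← Finset.sum_add_distrib]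
    refine Finset.sum_congr rfl fun j _ => ?_
    simp; ring
  rw [laplaceKernel, this, Complex.ofReal_exp, ← Complex.exp_add]
  congr 1
  push_cast
  linear_combination (2 * Real.pi * (inner ℝ t y : ℝ) : ℂ) * Complex.I_mul_I

theorem norm_laplaceKernel (t x y : EuclideanSpace ℝ (Fin n)) :
    ‖laplaceKernel t (cpoint x y)‖ = Real.exp (-2 * Real.pi * inner ℝ t y) := by
  rw [laplaceKernel_cpoint, norm_mul, Complex.norm_real, Real.norm_of_nonneg (Real.exp_nonneg _),
    show (2 * Real.pi * Complex.I * (inner ℝ t x : ℝ) : ℂ) =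
      ((2 * Real.pi * inner ℝ t x : ℝ) : ℂ) * Complex.I by push_cast; ring,
    Complex.norm_exp_ofReal_mul_I, one_mul]

theorem continuous_laplaceKernel : Continuous fun p : EuclideanSpace ℝ (Fin n) ×
    EuclideanSpace ℂ (Fin n) => laplaceKernel p.1 p.2 := by
  unfold laplaceKernel
  fun_prop

theorem differentiable_laplaceKernel (t : EuclideanSpace ℝ (Fin n)) :
    Differentiable ℂ (laplaceKernel t) := by
  unfold laplaceKernel
  fun_prop

/-- The entire function `∫ φ(t) e^{-2πi t·z} dt`. -/
noncomputable def fourierLaplace (φ : EuclideanSpace ℝ (Fin n) → ℂ)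
    (z : EuclideanSpace ℂ (Fin n)) : ℂ :=
  ∫ t, φ t * laplaceKernel t (-z)

theorem norm_laplaceKernel_neg (t x y : EuclideanSpace ℝ (Fin n)) :
    ‖laplaceKernel t (-cpoint x y)‖ = Real.exp (2 * Real.pi * inner ℝ t y) := by
  rw [neg_cpoint, norm_laplaceKernel, inner_neg_right]
  congr 1; ring

theorem continuous_mul_laplaceKernel {φ : EuclideanSpace ℝ (Fin n) → ℂ} (hφ : Continuous φ)
    (z : EuclideanSpace ℂ (Fin n)) : Continuous fun t => φ t * laplaceKernel t z :=
  hφ.mul (continuous_laplaceKernel.comp (continuous_id.prodMk continuous_const))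

theorem integrable_mul_laplaceKernel {φ : EuclideanSpace ℝ (Fin n) → ℂ} (hφ : Continuous φ)
    (hc : HasCompactSupport φ) (z : EuclideanSpace ℂ (Fin n)) :
    Integrable fun t => φ t * laplaceKernel t z :=
  (continuous_mul_laplaceKernel hφ z).integrable_of_hasCompactSupport hc.mul_right

open scoped FourierTransform in
theorem fourierLaplace_cpoint (φ : EuclideanSpace ℝ (Fin n) → ℂ)
    (x y : EuclideanSpace ℝ (Fin n)) :
    fourierLaplace φ (cpoint x y) =
      𝓕 (fun t => φ t * (Real.exp (2 * Real.pi * inner ℝ t y) : ℝ)) x := by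
  rw [fourierLaplace, Real.fourier_eq']
  congr 1; ext t
  rw [neg_cpoint, laplaceKernel_cpoint, inner_neg_right, inner_neg_right, smul_eq_mul]
  rw [show -2 * Real.pi * -inner ℝ t y = 2 * Real.pi * inner ℝ t y by ring]
  rw [show (2 * Real.pi * Complex.I * (-inner ℝ t x : ℝ) : ℂ) =
    ((-2 * Real.pi * inner ℝ t x : ℝ) : ℂ) * Complex.I by push_cast; ring]
  ring

/-- Keeping `H`, any upper bound of t·y over the support, explicit allows it later to be the value
at y of a single frequency. -/
theorem norm_fourierLaplace_le {φ : EuclideanSpace ℝ (Fin n) → ℂ} (hφ : Continuous φ)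
    (hc : HasCompactSupport φ) (x y : EuclideanSpace ℝ (Fin n)) (H : ℝ)
    (hH : ∀ t ∈ tsupport φ, inner ℝ t y ≤ H) :
    ‖fourierLaplace φ (cpoint x y)‖ ≤ (∫ t, ‖φ t‖) * Real.exp (2 * Real.pi * H) := by
  rw [← integral_mul_const]
  refine norm_integral_le_of_norm_le
    ((hφ.integrable_of_hasCompactSupport hc).norm.mul_const _) (ae_of_all _ fun t => ?_)
  rw [norm_mul, norm_laplaceKernel_neg]
  by_cases ht : t ∈ tsupport φ
  · have := hH t ht
    gcongr
  · simp [image_eq_zero_of_notMem_tsupport ht]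

theorem hasLineDerivAt_laplaceKernel_left (t : EuclideanSpace ℝ (Fin n))
    (z : EuclideanSpace ℂ (Fin n)) (j : Fin n) :
    HasLineDerivAt ℝ (fun t => laplaceKernel t z)
      (2 * Real.pi * Complex.I * z j * laplaceKernel t z) t (EuclideanSpace.single j 1) := by
  unfold HasLineDerivAt laplaceKernel
  have h : ∀ s : ℝ, ∑ k, (((t + s • EuclideanSpace.single j (1:ℝ)) k : ℝ) : ℂ) * z k =
      ∑ k, (t k : ℂ) * z k + s * z j := by
    intro s
    simp only [PiLp.add_apply, PiLp.smul_apply, smul_eq_mul, Complex.ofReal_add,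
      Complex.ofReal_mul, add_mul, Finset.sum_add_distrib, add_right_inj]
    rw [Finset.sum_eq_single j]
    · simp
    · intro b _ hb; simp [hb]
    · simp
  simp_rw [h]
  have h1 : HasDerivAt (fun s : ℝ => 2 * Real.pi * Complex.I *
      (∑ k, (t k : ℂ) * z k + s * z j)) (2 * Real.pi * Complex.I * z j) 0 := by
    have h2 : HasDerivAt (fun s : ℝ => (s : ℂ) * z j) (z j) 0 := by
      simpa using (Complex.ofRealCLM.hasDerivAt (x := (0:ℝ))).mul_const (z j)
    exact (h2.const_add _).const_mul _
  convert! h1.cexp using 1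
  simp; ring

theorem fourierLaplace_fderiv {φ : EuclideanSpace ℝ (Fin n) → ℂ} (hφ : ContDiff ℝ 1 φ)
    (hc : HasCompactSupport φ) (z : EuclideanSpace ℂ (Fin n)) (j : Fin n) :
    fourierLaplace (fun t => fderiv ℝ φ t (EuclideanSpace.single j 1)) z =
      2 * Real.pi * Complex.I * z j * fourierLaplace φ z := by
  have hd : Continuous fun t => fderiv ℝ φ t (EuclideanSpace.single j 1) :=
    (hφ.continuous_fderiv one_ne_zero).clm_apply continuous_const
  have hdc : HasCompactSupport fun t => fderiv ℝ φ t (EuclideanSpace.single j 1) :=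
    hc.fderiv_apply ℝ _
  have key := integral_bilinear_hasLineDerivAt_right_eq_neg_left_of_integrable
    (μ := (volume : Measure (EuclideanSpace ℝ (Fin n)))) (B := ContinuousLinearMap.mul ℝ ℂ)
    (f := φ) (f' := fun t => fderiv ℝ φ t (EuclideanSpace.single j 1))
    (g := fun t => laplaceKernel t (-z))
    (g' := fun t => 2 * Real.pi * Complex.I * (-z) j * laplaceKernel t (-z))
    (v := EuclideanSpace.single j 1) (integrable_mul_laplaceKernel hd hdc (-z)) ?_
    (integrable_mul_laplaceKernel hφ.continuous hc (-z))
    (fun t _ => ((hφ.differentiable one_ne_zero) t).hasFDerivAt.hasLineDerivAt _)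
    (fun t _ => hasLineDerivAt_laplaceKernel_left t (-z) j)
  · simp only [ContinuousLinearMap.mul_apply'] at key
    rw [fourierLaplace, fourierLaplace, ← neg_eq_iff_eq_neg.2 key, ← integral_const_mul,
      ← integral_neg]
    congr 1; ext t
    simp; ring
  · simp only [ContinuousLinearMap.mul_apply']
    refine ((integrable_mul_laplaceKernel hφ.continuous hc (-z)).const_mul
      (2 * Real.pi * Complex.I * (-z) j)).congr (ae_of_all _ fun t => ?_)
    simp only; ring

/-- Integration by parts trades each factor 2πi z_j for a derivative of φ. Differentiation does not
enlarge the support, so the same `H` serves throughout, while φ has to vary in the induction. -/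
theorem norm_coord_pow_mul_fourierLaplace_le (N : ℕ) (j : Fin n) :
    ∀ φ : EuclideanSpace ℝ (Fin n) → ℂ, ContDiff ℝ (⊤ : ℕ∞) φ → HasCompactSupport φ →
      ∃ C : ℝ, 0 ≤ C ∧ ∀ (x y : EuclideanSpace ℝ (Fin n)) (H : ℝ),
        (∀ t ∈ tsupport φ, inner ℝ t y ≤ H) →
        ‖cpoint x y j‖ ^ N * ‖fourierLaplace φ (cpoint x y)‖ ≤
          C * Real.exp (2 * Real.pi * H) := by
  induction N with
  | zero =>
    intro φ hφ hc
    refine ⟨∫ t, ‖φ t‖, by positivity, fun x y H hH => ?_⟩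
    simpa using norm_fourierLaplace_le hφ.continuous hc x y H hH
  | succ N ih =>
    intro φ hφ hc
    obtain ⟨C, hC, hb⟩ := ih (fun t => fderiv ℝ φ t (EuclideanSpace.single j 1))
      ((hφ.fderiv_right (m := (⊤ : ℕ∞)) (by simp)).clm_apply contDiff_const)
      (hc.fderiv_apply ℝ _)
    refine ⟨C, hC, fun x y H hH => ?_⟩
    have h := hb x y H fun t ht => hH t (tsupport_fderiv_apply_subset ℝ _ ht)
    rw [fourierLaplace_fderiv (hφ.of_le (by simp)) hc, norm_mul, norm_mul] at h
    refine le_trans ?_ h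
    have h2 : ‖(2 * Real.pi * Complex.I : ℂ)‖ = 2 * Real.pi := by
      simp [abs_of_pos Real.pi_pos]
    rw [h2, pow_succ]
    have h3 : 1 ≤ 2 * Real.pi := by linarith [Real.pi_gt_three]
    have h4 : 0 ≤ ‖cpoint x y j‖ ^ N * ‖cpoint x y j‖ * ‖fourierLaplace φ (cpoint x y)‖ := by
      positivity
    calc _ ≤ (2 * Real.pi) *
          (‖cpoint x y j‖ ^ N * ‖cpoint x y j‖ * ‖fourierLaplace φ (cpoint x y)‖) :=
          le_mul_of_one_le_left h4 h3
      _ = _ := by ring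

/-- Rapid decay of the Fourier-Laplace transform of a test function, with the exponential
factor given by its support. -/
theorem norm_fourierLaplace_decay (N : ℕ) {φ : EuclideanSpace ℝ (Fin n) → ℂ}
    (hφ : ContDiff ℝ (⊤ : ℕ∞) φ) (hc : HasCompactSupport φ) :
    ∃ C : ℝ, 0 ≤ C ∧ ∀ (x y : EuclideanSpace ℝ (Fin n)) (H : ℝ),
      (∀ t ∈ tsupport φ, inner ℝ t y ≤ H) →
      ‖fourierLaplace φ (cpoint x y)‖ ≤
        C * Real.exp (2 * Real.pi * H) * (1 + ‖x‖) ^ (-(N : ℝ)) := by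
  choose C hC hb using fun j : Fin n => norm_coord_pow_mul_fourierLaplace_le N j φ hφ hc
  set C₀ := ∫ t, ‖φ t‖ with hC₀
  have hC₀' : 0 ≤ C₀ := by positivity
  -- The factor 2^N comes from (1+|x|)^N ≤ 2^N(1+|x|^N), and n^N from |x| ≤ n max|x_j|. The inner
  -- `C₀` covers dimension zero, where there is no coordinate to choose.
  refine ⟨2 ^ N * (C₀ + (C₀ + (n : ℝ) ^ N * ∑ j, C j)), ?_, fun x y H hH => ?_⟩
  · have : 0 ≤ ∑ j, C j := Finset.sum_nonneg fun j _ => hC j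
    positivity
  set P := ‖fourierLaplace φ (cpoint x y)‖ with hP
  have hP0 : 0 ≤ P := norm_nonneg _
  have h0 : P ≤ C₀ * Real.exp (2 * Real.pi * H) :=
    norm_fourierLaplace_le hφ.continuous hc x y H hH
  have hx : ‖x‖ ^ N * P ≤ (C₀ + (n : ℝ) ^ N * ∑ j, C j) * Real.exp (2 * Real.pi * H) := by
    rcases Nat.eq_zero_or_pos n with h | hn
    · subst h
      have : x = 0 := Subsingleton.elim _ _
      refine le_trans ?_ (h0.trans (le_of_eq (by simp)))
      rw [this, norm_zero]
      exact mul_le_of_le_one_left hP0 (pow_le_one₀ le_rfl zero_le_one)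
    have : Nonempty (Fin n) := ⟨⟨0, hn⟩⟩
    obtain ⟨j, -, hj⟩ := Finset.exists_max_image Finset.univ (fun j => ‖x j‖) Finset.univ_nonempty
    have h1 : ‖x‖ ≤ n * ‖x j‖ := by
      rw [EuclideanSpace.norm_eq, Real.sqrt_le_left (by positivity)]
      calc ∑ i, ‖x i‖ ^ 2 ≤ ∑ i : Fin n, ‖x j‖ ^ 2 :=
            Finset.sum_le_sum fun i hi => by gcongr; exact hj i hi
        _ = n * ‖x j‖ ^ 2 := by simp
        _ ≤ (n * ‖x j‖) ^ 2 := by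
            rw [mul_pow]; gcongr
            have : (1:ℝ) ≤ n := by exact_mod_cast hn
            nlinarith
    have h2 : ‖x j‖ ≤ ‖cpoint x y j‖ := by
      have := Complex.abs_re_le_norm (cpoint x y j)
      simpa [cpoint] using this
    calc ‖x‖ ^ N * P ≤ (n * ‖cpoint x y j‖) ^ N * P := by
          gcongr; exact h1.trans (by gcongr)
      _ = (n:ℝ) ^ N * (‖cpoint x y j‖ ^ N * P) := by ring
      _ ≤ (n:ℝ) ^ N * (C j * Real.exp (2 * Real.pi * H)) := by
          exact mul_le_mul_of_nonneg_left (hb j x y H hH) (by positivity)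
      _ ≤ (n:ℝ) ^ N * ((∑ j, C j) * Real.exp (2 * Real.pi * H)) := by
          gcongr
          exact Finset.single_le_sum (fun i _ => hC i) (Finset.mem_univ j)
      _ = ((n : ℝ) ^ N * ∑ j, C j) * Real.exp (2 * Real.pi * H) := by ring
      _ ≤ _ := by
          gcongr
          exact le_add_of_nonneg_left hC₀'
  rw [Real.rpow_neg (by positivity), Real.rpow_natCast, ← div_eq_mul_inv,
    le_div_iff₀ (by positivity)]
  have h3 : (1 + ‖x‖) ^ N ≤ 2 ^ N * (1 + ‖x‖ ^ N) := by
    have := add_pow_le (zero_le_one' ℝ) (norm_nonneg x) N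
    rw [one_pow] at this
    refine this.trans ?_
    gcongr
    · norm_num
    · omega
  calc P * (1 + ‖x‖) ^ N ≤ P * (2 ^ N * (1 + ‖x‖ ^ N)) := by gcongr
    _ = 2 ^ N * (P + ‖x‖ ^ N * P) := by ring
    _ ≤ 2 ^ N * (C₀ * Real.exp (2 * Real.pi * H) +
        (C₀ + (n : ℝ) ^ N * ∑ j, C j) * Real.exp (2 * Real.pi * H)) := by gcongr
    _ = _ := by ring

end

/-! ### Independence of the slice, and local bounds from slice norms -/

section

variable {n : ℕ}

theorem differentiable_fourierLaplace_line {φ : EuclideanSpace ℝ (Fin n) → ℂ} (hφ : Continuous φ)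
    (hc : HasCompactSupport φ) (x y v : EuclideanSpace ℝ (Fin n)) :
    DifferentiableOn ℂ (fun ζ : ℂ => fourierLaplace φ (cpoint (x + ζ.re • v) (y + ζ.im • v)))
      Set.univ := by
  obtain ⟨R, hR⟩ := hc.isBounded.exists_norm_le
  unfold fourierLaplace
  refine differentiableOn_integral_of_dominated isOpen_univ
    (fun ζ _ => (continuous_mul_laplaceKernel hφ _).aestronglyMeasurable) (fun t => ?_) ?_
  · simp_rw [← cpoint_add_smul]
    refine Differentiable.differentiableOn ?_
    have := differentiable_laplaceKernel t
    fun_prop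
  · intro ζ₀ _
    refine ⟨1, one_pos, fun t => ‖φ t‖ * Real.exp (2 * Real.pi *
      (|R| * (‖y‖ + (‖ζ₀‖ + 1) * ‖v‖))), (hφ.integrable_of_hasCompactSupport hc).norm.mul_const _,
      fun ζ hζ _ t => ?_⟩
    rw [norm_mul, norm_laplaceKernel_neg]
    by_cases ht : t ∈ tsupport φ
    · beta_reduce
      gcongr
      have h1 : |ζ.im| ≤ ‖ζ₀‖ + 1 := by
        have h2 : dist ζ ζ₀ < 1 := hζ
        rw [dist_eq_norm] at h2
        have h3 := Complex.abs_im_le_norm ζ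
        have h4 := norm_le_norm_add_norm_sub ζ₀ ζ
        rw [norm_sub_rev] at h4
        linarith
      refine (real_inner_le_norm _ _).trans ?_
      have h5 : ‖t‖ ≤ |R| := (hR t ht).trans (le_abs_self R)
      have h6 : ‖y + ζ.im • v‖ ≤ ‖y‖ + (‖ζ₀‖ + 1) * ‖v‖ := by
        refine (norm_add_le _ _).trans ?_
        rw [norm_smul, Real.norm_eq_abs]
        gcongr
      gcongr
    · simp [image_eq_zero_of_notMem_tsupport ht]

theorem continuous_fourierLaplace_slice {φ : EuclideanSpace ℝ (Fin n) → ℂ}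
    (hφ : Continuous φ) (hc : HasCompactSupport φ) (y : EuclideanSpace ℝ (Fin n)) :
    Continuous fun x => fourierLaplace φ (cpoint x y) := by
  refine continuous_of_dominated (F := fun x t => φ t * laplaceKernel t (-cpoint x y))
    (bound := fun t => ‖φ t‖ * Real.exp (2 * Real.pi * inner ℝ t y))
    (fun x => (continuous_mul_laplaceKernel hφ _).aestronglyMeasurable)
    (fun x => ae_of_all _ fun t => ?_) ?_ (ae_of_all _ fun t => ?_)
  · rw [norm_mul, norm_laplaceKernel_neg]
  · exact (Continuous.mul hφ.norm (by fun_prop)).integrable_of_hasCompactSupport hc.norm.mul_right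
  · refine continuous_const.mul (continuous_laplaceKernel.comp (continuous_const.prodMk ?_))
    exact (continuous_cpoint.comp (continuous_id.prodMk continuous_const)).neg

/-- This is 1+|x| ≤ (1+K)(1+|x+a|), raised to a power; it keeps the decay uniform under bounded
translations. -/
theorem one_add_norm_rpow_neg_le (N : ℕ) {x a : EuclideanSpace ℝ (Fin n)} {K : ℝ}
    (ha : ‖a‖ ≤ K) :
    (1 + ‖x + a‖) ^ (-(N : ℝ)) ≤ (1 + K) ^ N * (1 + ‖x‖) ^ (-(N : ℝ)) := by
  have hK : 0 ≤ K := (norm_nonneg a).trans ha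
  rw [Real.rpow_neg (by positivity), Real.rpow_neg (by positivity), Real.rpow_natCast,
    Real.rpow_natCast, ← div_eq_mul_inv, inv_eq_one_div,
    div_le_div_iff₀ (by positivity) (by positivity), one_mul, ← mul_pow]
  have : ‖x‖ ≤ ‖x + a‖ + ‖a‖ := by
    simpa using norm_sub_le (x + a) a
  gcongr
  nlinarith [norm_nonneg (x + a)]

/-- The pairing of a function that is holomorphic on a tube and bounded on horizontal slices
with a Fourier-Laplace transform does not depend on the slice. -/
theorem integral_mul_fourierLaplace_eq {B : Set (EuclideanSpace ℝ (Fin n))} (hB : IsOpen B)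
    (hBc : Convex ℝ B) {F : EuclideanSpace ℂ (Fin n) → ℂ} (hF : DifferentiableOn ℂ F (tube B))
    (hloc : ∀ y ∈ B, ∃ r > 0, ∃ C, ∀ y' ∈ Metric.ball y r, y' ∈ B → ∀ x, ‖F (cpoint x y')‖ ≤ C)
    {φ : EuclideanSpace ℝ (Fin n) → ℂ} (hφ : ContDiff ℝ (⊤ : ℕ∞) φ) (hc : HasCompactSupport φ)
    {y₁ y₂ : EuclideanSpace ℝ (Fin n)} (h₁ : y₁ ∈ B) (h₂ : y₂ ∈ B) :
    ∫ x, F (cpoint x y₁) * fourierLaplace φ (cpoint x y₁) =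
      ∫ x, F (cpoint x y₂) * fourierLaplace φ (cpoint x y₂) := by
  set v := y₂ - y₁ with hv
  set U : Set ℂ := {ζ | y₁ + ζ.im • v ∈ B} with hU
  have hUo : IsOpen U := hB.preimage (f := fun ζ : ℂ => y₁ + ζ.im • v) (by fun_prop)
  have hUc : Convex ℝ U := by
    intro a ha b hb s t hs ht hst
    have := hBc ha hb hs ht hst
    simp only [hU, Set.mem_ofPred_eq]
    convert! this using 1
    simp only [Complex.add_im, Complex.real_smul, Complex.im_ofReal_mul, smul_add, add_smul,
      smul_smul]
    have : y₁ = s • y₁ + t • y₁ := by rw [← add_smul, hst, one_smul]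
    nth_rewrite 1 [this]
    abel
  -- No contour is shifted. The pairing along the complex line through the two slices is holomorphic
  -- in ζ, and translation invariance in x makes it independent of Re ζ. So its derivative vanishes,
  -- and the values at 0 and i agree.
  set H : ℂ → ℂ := fun ζ => ∫ x, F (cpoint (x + ζ.re • v) (y₁ + ζ.im • v)) *
    fourierLaplace φ (cpoint (x + ζ.re • v) (y₁ + ζ.im • v)) with hH
  obtain ⟨R, hR⟩ := hc.isBounded.exists_norm_le
  obtain ⟨CΦ, hCΦ, hdec⟩ := norm_fourierLaplace_decay (n + 1) hφ hc
  have hHd : DifferentiableOn ℂ H U := by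
    refine differentiableOn_integral_of_dominated hUo (fun ζ hζ => ?_) (fun x => ?_) ?_
    · refine Continuous.aestronglyMeasurable ?_
      have ht : Continuous fun x : EuclideanSpace ℝ (Fin n) => x + ζ.re • v := by fun_prop
      exact ((continuous_slice hF hζ).comp ht).mul
        ((continuous_fourierLaplace_slice hφ.continuous hc _).comp ht)
    · exact (differentiableOn_line hF x y₁ v).mul
        ((differentiable_fourierLaplace_line hφ.continuous hc x y₁ v).mono (Set.subset_univ _))
    · intro ζ₀ hζ₀
      obtain ⟨r, hr, C, hC⟩ := hloc _ hζ₀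
      set K := (‖ζ₀‖ + 1) * ‖v‖ with hK
      set Y := |R| * (‖y₁‖ + K) with hY
      -- The second radius keeps the slice inside the ball where F is bounded; the first keeps |ζ| ≤
      -- |ζ₀|+1, hence the translations bounded. The decay exponent n+1 exceeds the dimension, which
      -- gives integrability.
      refine ⟨min 1 (r / (‖v‖ + 1)), by positivity, fun x => C *
        (CΦ * Real.exp (2 * Real.pi * Y) *
          ((1 + K) ^ (n + 1) * (1 + ‖x‖) ^ (-((n + 1 : ℕ) : ℝ)))), ?_, fun ζ hζ hζU x => ?_⟩
      · refine (((integrable_one_add_norm ?_).const_mul _).const_mul _).const_mul _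
        simp
      · have hd1 : ‖ζ - ζ₀‖ < 1 := by
          rw [← dist_eq_norm]; exact lt_of_lt_of_le hζ (min_le_left _ _)
        have hd2 : ‖ζ - ζ₀‖ < r / (‖v‖ + 1) := by
          rw [← dist_eq_norm]; exact lt_of_lt_of_le hζ (min_le_right _ _)
        have hz : ‖ζ‖ ≤ ‖ζ₀‖ + 1 := by
          have h4 := norm_le_norm_add_norm_sub ζ₀ ζ
          rw [norm_sub_rev] at h4
          linarith
        have hF1 : ‖F (cpoint (x + ζ.re • v) (y₁ + ζ.im • v))‖ ≤ C := by
          refine hC _ ?_ hζU _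
          rw [Metric.mem_ball, dist_add_left, dist_eq_norm, ← sub_smul, norm_smul,
            ← Complex.sub_im, Real.norm_eq_abs]
          rw [lt_div_iff₀ (by positivity)] at hd2
          have := Complex.abs_im_le_norm (ζ - ζ₀)
          nlinarith [norm_nonneg v, norm_nonneg (ζ - ζ₀)]
        have hΦ := hdec (x + ζ.re • v) (y₁ + ζ.im • v) Y (fun t ht => by
          refine (real_inner_le_norm _ _).trans ?_
          have h5 : ‖t‖ ≤ |R| := (hR t ht).trans (le_abs_self R)
          have h6 : ‖y₁ + ζ.im • v‖ ≤ ‖y₁‖ + K := by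
            refine (norm_add_le _ _).trans ?_
            rw [norm_smul, Real.norm_eq_abs, hK]
            have := (Complex.abs_im_le_norm ζ).trans hz
            gcongr
          exact mul_le_mul h5 h6 (norm_nonneg _) (abs_nonneg R))
        have hJ : (1 + ‖x + ζ.re • v‖) ^ (-((n + 1 : ℕ) : ℝ)) ≤
            (1 + K) ^ (n + 1) * (1 + ‖x‖) ^ (-((n + 1 : ℕ) : ℝ)) := by
          refine one_add_norm_rpow_neg_le (n + 1) ?_
          rw [norm_smul, Real.norm_eq_abs, hK]
          have := (Complex.abs_re_le_norm ζ).trans hz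
          gcongr
        rw [norm_mul]
        refine mul_le_mul hF1 (hΦ.trans ?_) (norm_nonneg _) ((norm_nonneg _).trans hF1)
        exact mul_le_mul_of_nonneg_left hJ (by positivity)
  have hper : ∀ (ζ : ℂ) (s : ℝ), H (ζ + s) = H ζ := by
    intro ζ s
    simp only [hH, Complex.add_re, Complex.ofReal_re, Complex.add_im, Complex.ofReal_im, add_zero]
    rw [← integral_add_right_eq_self _ (-(s • v))]
    congr 1; ext x
    rw [show x + -(s • v) + (ζ.re + s) • v = x + ζ.re • v by rw [add_smul]; abel]
  have hder : U.EqOn (deriv H) 0 := by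
    intro ζ hζ
    have h := (hHd.differentiableAt (hUo.mem_nhds hζ)).hasDerivAt
    have h2 : HasDerivAt (fun s : ℝ => H (ζ + s)) (deriv H ζ) 0 := by
      have h3 : HasDerivAt (fun s : ℝ => ζ + (s : ℂ)) 1 0 := by
        simpa using (Complex.ofRealCLM.hasDerivAt (x := (0:ℝ))).const_add ζ
      have h' : HasDerivAt H (deriv H ζ) (ζ + ((0:ℝ) : ℂ)) := by simpa using h
      convert! h'.comp (0:ℝ) h3 using 1
      simp
    simp_rw [hper] at h2
    exact h2.unique (hasDerivAt_const _ _)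
  have h0 : (0 : ℂ) ∈ U := by simpa [hU] using h₁
  have hI : Complex.I ∈ U := by simpa [hU, hv] using h₂
  have := hUo.is_const_of_deriv_eq_zero hUc.isPreconnected hHd hder h0 hI
  simpa [hH, hv] using this

/-- The real part of a point of `ℂⁿ`. -/
def rePart (z : EuclideanSpace ℂ (Fin n)) : EuclideanSpace ℝ (Fin n) :=
  WithLp.toLp 2 (fun j => (z j).re)

theorem continuous_rePart : Continuous (rePart (n := n)) := by
  refine (PiLp.continuous_toLp 2 _).comp ?_
  fun_prop

theorem rePart_cpoint (x y : EuclideanSpace ℝ (Fin n)) : rePart (cpoint x y) = x := by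
  ext j; simp [rePart, cpoint]

theorem norm_rePart_le (z : EuclideanSpace ℂ (Fin n)) : ‖rePart z‖ ≤ ‖z‖ := by
  rw [EuclideanSpace.norm_eq, EuclideanSpace.norm_eq]
  gcongr
  exact Complex.abs_re_le_norm _

theorem norm_imPart_le (z : EuclideanSpace ℂ (Fin n)) : ‖imPart z‖ ≤ ‖z‖ := by
  rw [EuclideanSpace.norm_eq, EuclideanSpace.norm_eq]
  gcongr
  exact Complex.abs_im_le_norm _

theorem dist_le_dist_cpoint (x y x' y' : EuclideanSpace ℝ (Fin n)) :
    dist x x' ≤ dist (cpoint x y) (cpoint x' y') ∧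
      dist y y' ≤ dist (cpoint x y) (cpoint x' y') := by
  simp only [dist_eq_norm]
  constructor
  · convert! norm_rePart_le (cpoint x y - cpoint x' y') using 2
    ext j; simp [rePart, cpoint]
  · convert! norm_imPart_le (cpoint x y - cpoint x' y') using 2
    ext j; simp [imPart, cpoint]

/-- The identification of `ℝⁿ × ℝⁿ` with `ℂⁿ`. -/
def cpointAddEquiv (n : ℕ) :
    EuclideanSpace ℝ (Fin n) × EuclideanSpace ℝ (Fin n) ≃+ EuclideanSpace ℂ (Fin n) where
  toFun p := cpoint p.1 p.2
  invFun z := (rePart z, imPart z)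
  left_inv p := by simp [rePart_cpoint, imPart_cpoint]
  right_inv z := by ext j; simp [cpoint, rePart, imPart]
  map_add' p q := by ext j; simp [cpoint]; ring

/-- The sub-mean value inequality for |F|^q is applied on a ball of ℂⁿ, which lies in a product of
an x-ball and a y-ball. Hölder on the x-ball replaces the local L^q norm by the L^p norm of the
whole slice, so the bound does not depend on x. -/
theorem exists_local_bound {B : Set (EuclideanSpace ℝ (Fin n))} (hB : IsOpen B)
    {F : EuclideanSpace ℂ (Fin n) → ℂ} (hF : DifferentiableOn ℂ F (tube B)) {p : ℝ≥0∞}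
    (hp : 1 ≤ p) {q : ℝ} (hq : 0 < q) (hq1 : q ≤ 1) {y : EuclideanSpace ℝ (Fin n)} (hy : y ∈ B)
    {r : ℝ} (hr : 0 < r)
    (hint : ∫⁻ y' in Metric.ball y r, eLpNorm (fun x => F (cpoint x y')) p volume ^ q < ∞) :
    ∃ r' > 0, ∃ C, ∀ y' ∈ Metric.ball y r', y' ∈ B → ∀ x, ‖F (cpoint x y')‖ ≤ C := by
  obtain ⟨r₀, hr₀, hsub⟩ := Metric.isOpen_iff.1 hB y hy
  set ρ := min r r₀ / 3 with hρ
  have hρ0 : 0 < ρ := by positivity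
  have hρr : 2 * ρ < r := by linarith [min_le_left r r₀]
  have hρr₀ : 2 * ρ < r₀ := by linarith [min_le_right r r₀]
  set e := cpointAddEquiv n with he
  have hec : Continuous e := continuous_cpoint
  have hesc : Continuous e.symm := continuous_rePart.prodMk continuous_imPart
  -- Taking the image of the product measure as the Haar measure on ℂⁿ makes Fubini over slices
  -- immediate.
  set μ : Measure (EuclideanSpace ℂ (Fin n)) := (volume.prod volume).map e with hμ
  have hH : μ.IsAddHaarMeasure := e.isAddHaarMeasure_map _ hec hesc
  obtain ⟨C, hC, hmean⟩ := exists_enorm_rpow_le_lintegral μ hq hq1 hρ0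
  -- The Hölder constant between L^q and L^p on a ball of radius ρ. For `p = ∞` the term `1 /
  -- p.toReal` is 0, as it should be.
  set K : ℝ≥0∞ := volume (Metric.ball (0 : EuclideanSpace ℝ (Fin n)) ρ) ^ (1 / q - 1 / p.toReal)
    with hK
  have hKfin : K ≠ ∞ := by
    refine ENNReal.rpow_ne_top_of_ne_zero ?_ measure_ball_lt_top.ne
    exact (Metric.measure_ball_pos volume _ hρ0).ne'
  set J := ∫⁻ y' in Metric.ball y r, eLpNorm (fun x => F (cpoint x y')) p volume ^ q with hJ
  set D : ℝ≥0∞ := C * (K ^ q * J) with hD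
  have hDfin : D ≠ ∞ := ENNReal.mul_ne_top hC (ENNReal.mul_ne_top
    (ENNReal.rpow_ne_top_of_nonneg hq.le hKfin) hint.ne)
  refine ⟨ρ, hρ0, (D ^ (1 / q)).toReal, fun y' hy' _ x => ?_⟩
  have hcb : Metric.closedBall (cpoint x y') ρ ⊆ tube B := by
    intro u hu
    obtain ⟨x'', hx''⟩ := exists_eq_cpoint u
    rw [mem_tube_iff]
    apply hsub
    have h1 : dist u (cpoint x y') ≤ ρ := hu
    rw [hx''] at h1
    have h2 := (dist_le_dist_cpoint _ _ _ _).2.trans h1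
    have h3 : dist y' y < ρ := hy'
    have h4 := dist_triangle (imPart u) y' y
    rw [Metric.mem_ball]; linarith
  have key := hmean F (cpoint x y') _ hcb hF
  have hemb : MeasurableEmbedding e := by
    let eh : EuclideanSpace ℝ (Fin n) × EuclideanSpace ℝ (Fin n) ≃ₜ EuclideanSpace ℂ (Fin n) :=
      ⟨e.toEquiv, hec, hesc⟩
    exact eh.measurableEmbedding
  have hS : e ⁻¹' Metric.ball (cpoint x y') ρ ⊆ Metric.ball x ρ ×ˢ Metric.ball y (2 * ρ) := by
    rintro ⟨a, b⟩ hab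
    have h1 : dist (cpoint a b) (cpoint x y') < ρ := hab
    obtain ⟨h2, h3⟩ := dist_le_dist_cpoint a b x y'
    have h4 : dist y' y < ρ := hy'
    have h5 := dist_triangle b y' y
    exact ⟨lt_of_le_of_lt h2 h1, by rw [Metric.mem_ball]; linarith⟩
  have hSB : Metric.ball y (2 * ρ) ⊆ B := (Metric.ball_subset_ball hρr₀.le).trans hsub
  have hcont : ContinuousOn (fun z : EuclideanSpace ℝ (Fin n) × EuclideanSpace ℝ (Fin n) =>
      ‖F (cpoint z.1 z.2)‖ₑ ^ q) (Metric.ball x ρ ×ˢ Metric.ball y (2 * ρ)) := by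
    refine (ENNReal.continuous_rpow_const).comp_continuousOn (ContinuousOn.enorm ?_)
    exact hF.continuousOn.comp continuous_cpoint.continuousOn
      fun z hz => ⟨z.1, z.2, hSB hz.2, rfl⟩
  have hbound : ∫⁻ u in Metric.ball (cpoint x y') ρ, ‖F u‖ₑ ^ q ∂μ ≤ K ^ q * J := by
    rw [hμ, hemb.restrict_map, hemb.lintegral_map]
    calc ∫⁻ z in e ⁻¹' Metric.ball (cpoint x y') ρ, ‖F (e z)‖ₑ ^ q ∂(volume.prod volume)
        ≤ ∫⁻ z in Metric.ball x ρ ×ˢ Metric.ball y (2 * ρ), ‖F (cpoint z.1 z.2)‖ₑ ^ q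
            ∂(volume.prod volume) := lintegral_mono_set hS
      _ = ∫⁻ b in Metric.ball y (2 * ρ), ∫⁻ a in Metric.ball x ρ, ‖F (cpoint a b)‖ₑ ^ q := by
          rw [← Measure.prod_restrict, lintegral_prod_symm]
          rw [Measure.prod_restrict]
          exact hcont.aemeasurable (measurableSet_ball.prod measurableSet_ball)
      _ ≤ ∫⁻ b in Metric.ball y (2 * ρ),
            K ^ q * eLpNorm (fun x => F (cpoint x b)) p volume ^ q := by
          refine setLIntegral_mono' measurableSet_ball fun b hb => ?_
          have hm := (continuous_slice hF (hSB hb)).aestronglyMeasurable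
            (μ := volume.restrict (Metric.ball x ρ))
          have h1 := eLpNorm_le_eLpNorm_mul_rpow_measure_univ (p := ENNReal.ofReal q) (q := p)
            ((ENNReal.ofReal_le_one.2 hq1).trans hp) hm
          rw [Measure.restrict_apply_univ, Measure.addHaar_ball_center,
            ENNReal.toReal_ofReal hq.le, ← hK,
            eLpNorm_eq_lintegral_rpow_enorm_toReal (by simpa using hq) ENNReal.ofReal_ne_top,
            ENNReal.toReal_ofReal hq.le] at h1
          have h2 := ENNReal.rpow_le_rpow h1 hq.le
          rw [← ENNReal.rpow_mul, one_div_mul_cancel hq.ne', ENNReal.rpow_one,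
            ENNReal.mul_rpow_of_nonneg _ _ hq.le, mul_comm] at h2
          refine h2.trans ?_
          gcongr
          exact Measure.restrict_le_self
      _ = K ^ q * ∫⁻ b in Metric.ball y (2 * ρ),
            eLpNorm (fun x => F (cpoint x b)) p volume ^ q :=
          lintegral_const_mul' _ _ (ENNReal.rpow_ne_top_of_nonneg hq.le hKfin)
      _ ≤ K ^ q * J := by
          gcongr
          exact lintegral_mono_set (Metric.ball_subset_ball hρr.le)
  have hfin : ‖F (cpoint x y')‖ₑ ^ q ≤ D := key.trans (mul_le_mul_right hbound C)
  have h6 := ENNReal.rpow_le_rpow hfin (one_div_nonneg.2 hq.le)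
  rw [← ENNReal.rpow_mul, mul_one_div_cancel hq.ne', ENNReal.rpow_one] at h6
  rw [← toReal_enorm]
  exact ENNReal.toReal_mono (ENNReal.rpow_ne_top_of_nonneg (by positivity) hDfin) h6

end

/-! ### The L² density of the pairing -/

section

variable {n : ℕ}

/-- Hölder's inequality for the integral of a product. -/
theorem enorm_integral_mul_le {X : Type*} [MeasurableSpace X] {μ : Measure X} {f g : X → ℂ}
    (hf : AEStronglyMeasurable f μ) (hg : AEStronglyMeasurable g μ) (p q : ℝ≥0∞)
    [ENNReal.HolderConjugate p q] :
    ‖∫ x, f x * g x ∂μ‖ₑ ≤ eLpNorm f p μ * eLpNorm g q μ := by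
  have h := eLpNorm_smul_le_mul_eLpNorm (p := p) (q := q) (r := 1) hg hf
  rw [eLpNorm_one_eq_lintegral_enorm] at h
  exact (enorm_integral_le_lintegral_enorm _).trans h

/-- The space of test functions. -/
def testFunctions (n : ℕ) : Submodule ℂ (EuclideanSpace ℝ (Fin n) → ℂ) where
  carrier := {φ | ContDiff ℝ (⊤ : ℕ∞) φ ∧ HasCompactSupport φ}
  add_mem' ha hb := ⟨ha.1.add hb.1, ha.2.add hb.2⟩
  zero_mem' := ⟨contDiff_const, HasCompactSupport.zero⟩
  smul_mem' c _ ha := ⟨contDiff_const.smul ha.1, ha.2.smul_left (f := fun _ => c)⟩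

theorem memLp_testFunction (φ : testFunctions n) (p : ℝ≥0∞) :
    MemLp (φ : EuclideanSpace ℝ (Fin n) → ℂ) p volume :=
  φ.2.1.continuous.memLp_of_hasCompactSupport φ.2.2

/-- The inclusion of the test functions into `L²`. -/
noncomputable def testFunctionsToLp (n : ℕ) :
    testFunctions n →ₗ[ℂ] Lp ℂ 2 (volume : Measure (EuclideanSpace ℝ (Fin n))) where
  toFun φ := (memLp_testFunction φ 2).toLp φ
  map_add' _ _ := MemLp.toLp_add _ _
  map_smul' c _ := MemLp.toLp_const_smul c _

theorem testFunctionsToLp_injective (n : ℕ) : Function.Injective (testFunctionsToLp n) := by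
  intro φ χ h
  have h1 := (MemLp.toLp_eq_toLp_iff (memLp_testFunction φ 2) (memLp_testFunction χ 2)).1 h
  exact Subtype.ext ((φ.2.1.continuous.ae_eq_iff_eq volume χ.2.1.continuous).1 h1)

/-- A linear functional on test functions that is bounded for the `L²` norm is given by a square
integrable density. -/
theorem exists_memLp_two_of_bounded (Λ : testFunctions n →ₗ[ℂ] ℂ) (C : ℝ)
    (hΛ : ∀ φ : testFunctions n, ‖Λ φ‖ ≤
      C * (eLpNorm (φ : EuclideanSpace ℝ (Fin n) → ℂ) 2 volume).toReal) :
    ∃ f : EuclideanSpace ℝ (Fin n) → ℂ, MemLp f 2 volume ∧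
      ∀ φ : testFunctions n, Λ φ = ∫ t, f t * (φ : EuclideanSpace ℝ (Fin n) → ℂ) t := by
  -- The functional is transported to the image of the test functions in L², extended by Hahn–Banach
  -- and represented by Riesz. The inner product is conjugate linear in its first argument, hence
  -- the `star` in the density.
  let e := LinearEquiv.ofInjective (testFunctionsToLp n) (testFunctionsToLp_injective n)
  let ℓ : StrongDual ℂ (LinearMap.range (testFunctionsToLp n)) :=
    (Λ ∘ₗ e.symm.toLinearMap).mkContinuous C (by
      intro u
      obtain ⟨φ, rfl⟩ := e.surjective u
      have h1 : ‖e φ‖ = (eLpNorm (φ : EuclideanSpace ℝ (Fin n) → ℂ) 2 volume).toReal :=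
        Lp.norm_toLp _ (memLp_testFunction φ 2)
      rw [h1]
      simpa using hΛ φ)
  obtain ⟨g, hg, -⟩ := exists_extension_norm_eq _ ℓ
  set u := (InnerProductSpace.toDual ℂ
    (Lp ℂ 2 (volume : Measure (EuclideanSpace ℝ (Fin n))))).symm g with hu
  refine ⟨fun t => star (u t), (Lp.memLp u).star, fun φ => ?_⟩
  have h1 : g (testFunctionsToLp n φ) = Λ φ := by
    have := hg (e φ)
    simpa [ℓ, e] using this
  rw [← h1, ← InnerProductSpace.toDual_symm_apply, L2.inner_def]
  refine integral_congr_ae ?_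
  filter_upwards [MemLp.coeFn_toLp (memLp_testFunction φ 2)] with t ht
  have : (testFunctionsToLp n φ) t = (φ : EuclideanSpace ℝ (Fin n) → ℂ) t := ht
  rw [this, ← hu]
  simp [mul_comm]

theorem contDiff_exp_inner (c : ℝ) (y : EuclideanSpace ℝ (Fin n)) :
    ContDiff ℝ (⊤ : ℕ∞) fun t : EuclideanSpace ℝ (Fin n) =>
      ((Real.exp (c * inner ℝ t y) : ℝ) : ℂ) :=
  Complex.ofRealCLM.contDiff.comp
    (Real.contDiff_exp.comp (contDiff_const.mul (contDiff_id.inner ℝ contDiff_const)))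

-- Plancherel for the test function φ(t) e^{2π t·y}, whose Fourier transform is the slice of Φ at
-- height y.
open scoped FourierTransform SchwartzMap in
theorem eLpNorm_fourierLaplace_two {φ : EuclideanSpace ℝ (Fin n) → ℂ}
    (hφ : ContDiff ℝ (⊤ : ℕ∞) φ) (hc : HasCompactSupport φ) (y : EuclideanSpace ℝ (Fin n)) :
    eLpNorm (fun x => fourierLaplace φ (cpoint x y)) 2 volume =
      eLpNorm (fun t => φ t * (Real.exp (2 * Real.pi * inner ℝ t y) : ℝ)) 2 volume := by
  have h1 : ContDiff ℝ (⊤ : ℕ∞)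
      fun t => φ t * ((Real.exp (2 * Real.pi * inner ℝ t y) : ℝ) : ℂ) :=
    hφ.mul (contDiff_exp_inner _ y)
  have h2 : HasCompactSupport fun t => φ t * ((Real.exp (2 * Real.pi * inner ℝ t y) : ℝ) : ℂ) :=
    hc.mul_right
  let S : 𝓢(EuclideanSpace ℝ (Fin n), ℂ) := h2.toSchwartzMap h1
  have h3 := SchwartzMap.norm_fourier_toL2_eq S
  rw [SchwartzMap.norm_toLp, SchwartzMap.norm_toLp,
    ENNReal.toReal_eq_toReal_iff' (SchwartzMap.eLpNorm_lt_top _ _ _).ne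
      (SchwartzMap.eLpNorm_lt_top _ _ _).ne] at h3
  have h4 : (fun x => fourierLaplace φ (cpoint x y)) = (𝓕 S : 𝓢(EuclideanSpace ℝ (Fin n), ℂ)) := by
    ext x
    rw [fourierLaplace_cpoint, SchwartzMap.fourier_coe]
    rfl
  rw [h4, h3]
  rfl

/-- On a bounded support the weight is at most e^{2πR|y|}, which tends to 1 as y → 0 and so
disappears from the final bound. -/
theorem eLpNorm_mul_exp_inner_le {φ : EuclideanSpace ℝ (Fin n) → ℂ} {R : ℝ}
    (hR : ∀ t ∈ tsupport φ, ‖t‖ ≤ R) (y : EuclideanSpace ℝ (Fin n)) :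
    eLpNorm (fun t => φ t * (Real.exp (2 * Real.pi * inner ℝ t y) : ℝ)) 2 volume ≤
      ENNReal.ofReal (Real.exp (2 * Real.pi * (R * ‖y‖))) * eLpNorm φ 2 volume := by
  refine eLpNorm_le_mul_eLpNorm_of_ae_le_mul (ae_of_all _ fun t => ?_) 2
  rw [norm_mul, Complex.norm_real, Real.norm_of_nonneg (Real.exp_nonneg _), mul_comm]
  by_cases ht : t ∈ tsupport φ
  · gcongr
    exact (real_inner_le_norm _ _).trans (by gcongr; exact hR t ht)
  · simp [image_eq_zero_of_notMem_tsupport ht]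

theorem integrable_fourierLaplace {φ : EuclideanSpace ℝ (Fin n) → ℂ}
    (hφ : ContDiff ℝ (⊤ : ℕ∞) φ) (hc : HasCompactSupport φ) (y : EuclideanSpace ℝ (Fin n)) :
    Integrable fun x => fourierLaplace φ (cpoint x y) := by
  obtain ⟨C, hC, hdec⟩ := norm_fourierLaplace_decay (n + 1) hφ hc
  obtain ⟨R, hR⟩ := hc.isBounded.exists_norm_le
  refine Integrable.mono' (g := fun x => C * Real.exp (2 * Real.pi * (R * ‖y‖)) *
    (1 + ‖x‖) ^ (-((n + 1 : ℕ) : ℝ))) ?_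
    (continuous_fourierLaplace_slice hφ.continuous hc y).aestronglyMeasurable
    (ae_of_all _ fun x => hdec x y _ fun t ht => ?_)
  · refine (integrable_one_add_norm ?_).const_mul _
    simp
  · exact (real_inner_le_norm _ _).trans (by gcongr; exact hR t ht)

/-- The density of a holomorphic function on a tube that is bounded on horizontal slices and
square integrable on slices approaching the real space. -/
theorem exists_density {B : Set (EuclideanSpace ℝ (Fin n))} (hB : IsOpen B)
    (hBc : Convex ℝ B) {F : EuclideanSpace ℂ (Fin n) → ℂ} (hF : DifferentiableOn ℂ F (tube B))
    (hloc : ∀ y ∈ B, ∃ r > 0, ∃ C, ∀ y' ∈ Metric.ball y r, y' ∈ B → ∀ x, ‖F (cpoint x y')‖ ≤ C)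
    (hlim : liminf (fun y => ∫⁻ x : EuclideanSpace ℝ (Fin n),
      ‖F (cpoint x y)‖ₑ ^ 2) (𝓝[B] 0) < ∞) :
    ∃ f : EuclideanSpace ℝ (Fin n) → ℂ, MemLp f 2 volume ∧
      ∀ φ : EuclideanSpace ℝ (Fin n) → ℂ, ContDiff ℝ (⊤ : ℕ∞) φ → HasCompactSupport φ →
        ∀ y ∈ B, ∫ x, F (cpoint x y) * fourierLaplace φ (cpoint x y) = ∫ t, f t * φ t := by
  rcases B.eq_empty_or_nonempty with rfl | ⟨y₀, hy₀⟩
  · exact ⟨0, MemLp.zero, by simp⟩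
  have hint : ∀ (φ : testFunctions n), ∀ y ∈ B,
      Integrable fun x => F (cpoint x y) * fourierLaplace φ (cpoint x y) := by
    intro φ y hy
    obtain ⟨r, hr, C, hC⟩ := hloc y hy
    refine (integrable_fourierLaplace φ.2.1 φ.2.2 y).bdd_mul
      (continuous_slice hF hy).aestronglyMeasurable (c := C) (ae_of_all _ fun x => ?_)
    exact hC y (Metric.mem_ball_self hr) hy x
  have hadd : ∀ (φ χ : testFunctions n) z, fourierLaplace
      ((φ + χ : testFunctions n) : EuclideanSpace ℝ (Fin n) → ℂ) z =
        fourierLaplace φ z + fourierLaplace χ z := by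
    intro φ χ z
    simp only [fourierLaplace]
    rw [← integral_add (integrable_mul_laplaceKernel φ.2.1.continuous φ.2.2 _)
      (integrable_mul_laplaceKernel χ.2.1.continuous χ.2.2 _)]
    congr 1; ext t
    simp [add_mul]
  have hsmul : ∀ (c : ℂ) (φ : testFunctions n) z, fourierLaplace
      ((c • φ : testFunctions n) : EuclideanSpace ℝ (Fin n) → ℂ) z = c * fourierLaplace φ z := by
    intro c φ z
    simp only [fourierLaplace]
    rw [← integral_const_mul]
    congr 1; ext t
    simp [mul_assoc]
  let Λ : testFunctions n →ₗ[ℂ] ℂ :=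
    { toFun := fun φ => ∫ x, F (cpoint x y₀) * fourierLaplace φ (cpoint x y₀)
      map_add' := fun φ χ => by
        simp only [hadd, mul_add]
        exact integral_add (hint φ y₀ hy₀) (hint χ y₀ hy₀)
      map_smul' := fun c φ => by
        simp only [hsmul, RingHom.id_apply, smul_eq_mul]
        rw [← integral_const_mul]
        congr 1; ext x; ring }
  have hΛ : ∀ φ : testFunctions n, ∀ y ∈ B,
      Λ φ = ∫ x, F (cpoint x y) * fourierLaplace φ (cpoint x y) := fun φ y hy =>
    integral_mul_fourierLaplace_eq hB hBc hF hloc φ.2.1 φ.2.2 hy₀ hy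
  obtain ⟨L, hL, hLfin⟩ := exists_between hlim
  have hfreq := frequently_lt_of_liminf_lt (by isBoundedDefault) hL
  have hbound : ∀ φ : testFunctions n, ‖Λ φ‖ ≤ (L ^ (1 / 2 : ℝ)).toReal *
      (eLpNorm (φ : EuclideanSpace ℝ (Fin n) → ℂ) 2 volume).toReal := by
    intro φ
    obtain ⟨R, hR⟩ := φ.2.2.isBounded.exists_norm_le
    have hφfin : eLpNorm (φ : EuclideanSpace ℝ (Fin n) → ℂ) 2 volume ≠ ∞ :=
      (memLp_testFunction φ 2).eLpNorm_ne_top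
    have hLr : L ^ (1 / 2 : ℝ) ≠ ∞ := ENNReal.rpow_ne_top_of_nonneg (by norm_num) hLfin.ne
    set M := (L ^ (1 / 2 : ℝ)).toReal *
      (eLpNorm (φ : EuclideanSpace ℝ (Fin n) → ℂ) 2 volume).toReal with hM
    -- Finiteness of the lower limit controls slices only frequently near 0. This is enough because
    -- `Λ φ` does not depend on y.
    have hev : ∃ᶠ y in 𝓝[B] (0 : EuclideanSpace ℝ (Fin n)),
        ‖Λ φ‖ ≤ Real.exp (2 * Real.pi * (R * ‖y‖)) * M := by
      refine (hfreq.and_eventually self_mem_nhdsWithin).mono ?_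
      rintro y ⟨hy, hyB⟩
      have h1 := enorm_integral_mul_le (μ := volume)
        (continuous_slice hF hyB).aestronglyMeasurable
        (continuous_fourierLaplace_slice φ.2.1.continuous φ.2.2 y).aestronglyMeasurable 2 2
      rw [← hΛ φ y hyB, eLpNorm_fourierLaplace_two φ.2.1 φ.2.2] at h1
      have h2 : eLpNorm (fun x => F (cpoint x y)) 2 volume ≤ L ^ (1 / 2 : ℝ) := by
        rw [eLpNorm_eq_lintegral_rpow_enorm_toReal two_ne_zero ENNReal.ofNat_ne_top]
        simp only [ENNReal.toReal_ofNat, ENNReal.rpow_ofNat]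
        gcongr
      have h3 := h1.trans (mul_le_mul' h2 (eLpNorm_mul_exp_inner_le hR y))
      have h4 := ENNReal.toReal_mono (ENNReal.mul_ne_top hLr
        (ENNReal.mul_ne_top ENNReal.ofReal_ne_top hφfin)) h3
      rw [toReal_enorm, ENNReal.toReal_mul, ENNReal.toReal_mul,
        ENNReal.toReal_ofReal (Real.exp_nonneg _)] at h4
      refine h4.trans (le_of_eq ?_)
      rw [hM]; ring
    have hcont : Tendsto (fun y : EuclideanSpace ℝ (Fin n) =>
        Real.exp (2 * Real.pi * (R * ‖y‖)) * M) (𝓝[B] 0) (𝓝 M) := by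
      have : Continuous fun y : EuclideanSpace ℝ (Fin n) =>
        Real.exp (2 * Real.pi * (R * ‖y‖)) * M := by fun_prop
      have h5 := (this.tendsto 0).mono_left (nhdsWithin_le_nhds (s := B))
      simpa using h5
    exact ge_of_tendsto_of_frequently hcont hev
  obtain ⟨f, hf, hfΛ⟩ := exists_memLp_two_of_bounded Λ _ hbound
  exact ⟨f, hf, fun φ hφ hc y hy => (hΛ ⟨φ, hφ, hc⟩ y hy).symm.trans (hfΛ ⟨φ, hφ, hc⟩)⟩

end

/-! ### Geometry of the cone and of the support set -/

section

variable {n : ℕ} {Γ : Set (EuclideanSpace ℝ (Fin n))}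

theorem IsRegularOpenConvexCone.convex (hΓ : IsRegularOpenConvexCone Γ) : Convex ℝ Γ :=
  convex_iff_forall_pos.2 fun x hx y hy a b ha hb _ => hΓ.combo_mem x hx y hy a b ha hb

theorem IsRegularOpenConvexCone.smul_mem (hΓ : IsRegularOpenConvexCone Γ)
    {y : EuclideanSpace ℝ (Fin n)} (hy : y ∈ Γ) {a : ℝ} (ha : 0 < a) : a • y ∈ Γ := by
  have := hΓ.combo_mem y hy y hy (a / 2) (a / 2) (by positivity) (by positivity)
  rwa [← add_smul, add_halves] at this

theorem IsRegularOpenConvexCone.dim_pos (hΓ : IsRegularOpenConvexCone Γ) : 0 < n := by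
  rcases Nat.eq_zero_or_pos n with rfl | h
  · obtain ⟨y, hy⟩ := hΓ.nonempty
    exact absurd (Subsingleton.elim y 0 ▸ hy) hΓ.zero_notMem
  · exact h

/-- An interior point e of the dual cone stays in it after subtracting a vector of length r/2 in the
direction of y; pairing the difference with y gives the bound. -/
theorem IsRegularOpenConvexCone.exists_coercive (hΓ : IsRegularOpenConvexCone Γ) :
    ∃ (e : EuclideanSpace ℝ (Fin n)) (c : ℝ), 0 < c ∧ ∀ y ∈ Γ, c * ‖y‖ ≤ inner ℝ e y := by
  obtain ⟨e, he⟩ := hΓ.regular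
  obtain ⟨r, hr, hsub⟩ := Metric.isOpen_iff.1 isOpen_interior e he
  refine ⟨e, r / 2, by positivity, fun y hy => ?_⟩
  have hy0 : y ≠ 0 := fun h => hΓ.zero_notMem (h ▸ hy)
  have hn : 0 < ‖y‖ := norm_pos_iff.2 hy0
  have hmem : e - (r / 2 / ‖y‖) • y ∈ dualCone Γ := by
    refine interior_subset (hsub ?_)
    rw [Metric.mem_ball, dist_self_sub_left, norm_smul, Real.norm_of_nonneg (by positivity),
      div_mul_cancel₀ _ hn.ne']
    linarith
  have h := hmem y hy
  rw [inner_sub_left, real_inner_smul_left, real_inner_self_eq_norm_sq] at h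
  have : r / 2 / ‖y‖ * ‖y‖ ^ 2 = r / 2 * ‖y‖ := by field_simp
  linarith

theorem exists_linear_bound_of_growthRate_lt_top {ψ : EuclideanSpace ℝ (Fin n) → ℝ}
    (hR : growthRate Γ ψ < ⊤) :
    ∃ A R : ℝ, 0 ≤ A ∧ ∀ y ∈ Γ, R ≤ ‖y‖ → ψ y ≤ A * ‖y‖ := by
  obtain ⟨a, ha, -⟩ := EReal.lt_iff_exists_real_btwn.1 hR
  have hev := eventually_lt_of_limsup_lt ha
  rw [eventually_inf_principal] at hev
  obtain ⟨R, -, hR'⟩ := (hasBasis_cobounded_norm).eventually_iff.1 hev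
  refine ⟨max a 0, max R 1, le_max_right _ _, fun y hy hyR => ?_⟩
  have h := hR' (show y ∈ {x | R ≤ ‖x‖} from (le_max_left _ _).trans hyR) hy
  have h1 : ψ y / ‖y‖ < a := by exact_mod_cast h
  have hpos : 0 < ‖y‖ := lt_of_lt_of_le (by positivity) ((le_max_right R 1).trans hyR)
  rw [div_lt_iff₀ hpos] at h1
  exact h1.le.trans (by gcongr; exact le_max_left _ _)

/-- Convexity is needed because it makes the frontier of the support set null. For a finite exponent
it comes from the convexity of exp. -/
theorem convex_supportSet (hB : MeasurableSet Γ) {ψ : EuclideanSpace ℝ (Fin n) → ℝ}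
    (hψ : ContinuousOn ψ Γ) (q : ℝ≥0∞) : Convex ℝ (supportSet q Γ ψ) := by
  intro t ht u hu a b ha hb hab
  simp only [supportSet, Set.mem_ofPred_eq] at ht hu ⊢
  split_ifs at ht hu ⊢ with hq
  · obtain ⟨m, hm⟩ := ht
    obtain ⟨k, hk⟩ := hu
    refine ⟨a * m + b * k, ?_⟩
    rintro _ ⟨y, hy, rfl⟩
    have h1 := hm ⟨y, hy, rfl⟩
    have h2 := hk ⟨y, hy, rfl⟩
    simp only at h1 h2 ⊢
    rw [inner_add_right, real_inner_smul_right, real_inner_smul_right]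
    have : ψ y = a * ψ y + b * ψ y := by rw [← add_mul, hab, one_mul]
    rw [this]
    nlinarith
  · have hmeas : ∀ t : EuclideanSpace ℝ (Fin n), AEMeasurable (fun y => ENNReal.ofReal
        (Real.exp (-2 * Real.pi * q.toReal * (inner ℝ t y + ψ y)))) (volume.restrict Γ) := by
      intro t
      refine ContinuousOn.aemeasurable ?_ hB
      refine ENNReal.continuous_ofReal.comp_continuousOn ?_
      exact Real.continuous_exp.comp_continuousOn
        (continuousOn_const.mul (ContinuousOn.add (by fun_prop) hψ))
    refine lt_of_le_of_lt (lintegral_mono (g := fun y =>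
      ENNReal.ofReal (Real.exp (-2 * Real.pi * q.toReal * (inner ℝ t y + ψ y))) +
      ENNReal.ofReal (Real.exp (-2 * Real.pi * q.toReal * (inner ℝ u y + ψ y)))) fun y => ?_) ?_
    · beta_reduce
      rw [← ENNReal.ofReal_add (Real.exp_nonneg _) (Real.exp_nonneg _)]
      refine ENNReal.ofReal_le_ofReal ?_
      have h := convexOn_exp.2 (Set.mem_univ (-2 * Real.pi * q.toReal * (inner ℝ t y + ψ y)))
        (Set.mem_univ (-2 * Real.pi * q.toReal * (inner ℝ u y + ψ y))) ha hb hab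
      simp only [smul_eq_mul] at h
      have e1 : -2 * Real.pi * q.toReal * (inner ℝ (a • t + b • u) y + ψ y) =
          a * (-2 * Real.pi * q.toReal * (inner ℝ t y + ψ y)) +
          b * (-2 * Real.pi * q.toReal * (inner ℝ u y + ψ y)) := by
        rw [inner_add_left, real_inner_smul_left, real_inner_smul_left]
        linear_combination (2 * Real.pi * q.toReal * ψ y) * hab
      rw [e1]
      refine h.trans (add_le_add ?_ ?_)
      · exact mul_le_of_le_one_left (Real.exp_nonneg _) (by linarith)
      · exact mul_le_of_le_one_left (Real.exp_nonneg _) (by linarith)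
    · rw [lintegral_add_left' (hmeas t)]
      exact ENNReal.add_lt_top.2 ⟨ht, hu⟩

/-- Points of the support set are bounded below on the cone by a multiple of the norm. -/
theorem neg_mul_norm_le_inner_of_mem_supportSet (hΓ : IsRegularOpenConvexCone Γ)
    {ψ : EuclideanSpace ℝ (Fin n) → ℝ} {A R : ℝ}
    (hA : ∀ y ∈ Γ, R ≤ ‖y‖ → ψ y ≤ A * ‖y‖) {q : ℝ≥0∞} {t : EuclideanSpace ℝ (Fin n)}
    (ht : t ∈ supportSet q Γ ψ) {v : EuclideanSpace ℝ (Fin n)} (hv : v ∈ Γ) :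
    -A * ‖v‖ ≤ inner ℝ t v := by
  by_contra! hlt
  simp only [supportSet, Set.mem_ofPred_eq] at ht
  have hv0 : 0 < ‖v‖ := norm_pos_iff.2 fun h => hΓ.zero_notMem (h ▸ hv)
  split_ifs at ht with hq
  · obtain ⟨m, hm⟩ := ht
    set δ := -A * ‖v‖ - inner ℝ t v with hδ
    have hδ0 : 0 < δ := by rw [hδ]; linarith
    -- Along the ray, t·(av) + ψ(av) ≤ -aδ once a|v| ≥ R; the last entry makes this at most m - 1,
    -- below the lower bound m.
    set a := max 1 (max (R / ‖v‖) ((1 - m) / δ)) with ha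
    have ha1 : 1 ≤ a := le_max_left _ _
    have haR : R / ‖v‖ ≤ a := (le_max_left _ _).trans (le_max_right _ _)
    have ham : (1 - m) / δ ≤ a := (le_max_right _ _).trans (le_max_right _ _)
    have ha0 : 0 < a := by linarith
    have h1 := hm ⟨a • v, hΓ.smul_mem hv ha0, rfl⟩
    have h2 := hA (a • v) (hΓ.smul_mem hv ha0) (by
      rw [norm_smul, Real.norm_of_nonneg ha0.le]
      exact (div_le_iff₀ hv0).1 haR)
    rw [norm_smul, Real.norm_of_nonneg ha0.le] at h2
    simp only [real_inner_smul_left] at h1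
    rw [real_inner_comm] at h1
    rw [div_le_iff₀ hδ0] at ham
    nlinarith
  -- For a finite exponent the strict inequality persists on a ball about v. On its large dilates,
  -- contained in Γ, the integrand is at least 1, while their volumes are unbounded, so the integral
  -- diverges.
  · set W : Set (EuclideanSpace ℝ (Fin n)) := Γ ∩ {y | inner ℝ t y + A * ‖y‖ < 0} with hW
    have hWo : IsOpen W := hΓ.isOpen.inter (isOpen_lt (by fun_prop) continuous_const)
    have hvW : v ∈ W := ⟨hv, by simp only [Set.mem_ofPred_eq]; linarith⟩
    obtain ⟨r, hr, hsub⟩ := Metric.isOpen_iff.1 hWo v hvW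
    -- Points of the ball then have norm at least |v|/2, so a ≥ 2R/|v| puts their dilates where the
    -- linear bound on ψ holds.
    set ρ := min r (‖v‖ / 2) with hρ
    have hρ0 : 0 < ρ := by positivity
    set I := ∫⁻ y in Γ, ENNReal.ofReal
      (Real.exp (-2 * Real.pi * q.toReal * (inner ℝ t y + ψ y))) with hI
    set b := volume (Metric.ball (0 : EuclideanSpace ℝ (Fin n)) ρ) with hb
    have hb0 : b ≠ 0 := (Metric.measure_ball_pos volume _ hρ0).ne'
    have key : ∀ a : ℝ, 1 ≤ a → 2 * R / ‖v‖ ≤ a → ENNReal.ofReal a * b ≤ I := by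
      intro a ha1 haR
      have ha0 : 0 < a := by linarith
      have hmem : ∀ y ∈ Metric.ball (a • v) (a * ρ), y ∈ Γ ∧
          inner ℝ t y + ψ y ≤ 0 := by
        intro y hy
        have h1 : a⁻¹ • y ∈ Metric.ball v ρ := by
          rw [Metric.mem_ball, dist_eq_norm] at hy ⊢
          have : a⁻¹ • y - v = a⁻¹ • (y - a • v) := by
            rw [smul_sub, smul_smul, inv_mul_cancel₀ ha0.ne', one_smul]
          rw [this, norm_smul, Real.norm_of_nonneg (by positivity), inv_mul_lt_iff₀ ha0]
          exact hy
        have h2 : a⁻¹ • y ∈ W := hsub (Metric.ball_subset_ball (min_le_left _ _) h1)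
        have hy' : y = a • (a⁻¹ • y) := by rw [smul_smul, mul_inv_cancel₀ ha0.ne', one_smul]
        set w := a⁻¹ • y with hw
        have hyΓ : y ∈ Γ := hy' ▸ hΓ.smul_mem h2.1 ha0
        refine ⟨hyΓ, ?_⟩
        have h3 : inner ℝ t w + A * ‖w‖ < 0 := h2.2
        have hwn : ‖v‖ / 2 ≤ ‖w‖ := by
          have h4 : dist w v < ‖v‖ / 2 := lt_of_lt_of_le h1 (min_le_right _ _)
          rw [dist_eq_norm] at h4
          have := norm_le_norm_add_norm_sub w v
          linarith
        have hyn : ‖y‖ = a * ‖w‖ := by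
          rw [hy', norm_smul, Real.norm_of_nonneg ha0.le]
        have h5 := hA y hyΓ (by
          rw [hyn]
          rw [div_le_iff₀ hv0] at haR
          nlinarith)
        have h6 : inner ℝ t y = a * inner ℝ t w := by
          conv_lhs => rw [hy']
          rw [real_inner_smul_right]
        rw [h6]
        rw [hyn] at h5
        nlinarith
      calc ENNReal.ofReal a * b ≤ ENNReal.ofReal (a ^ n) * b := by
            gcongr
            exact le_self_pow₀ ha1 hΓ.dim_pos.ne'
        _ = volume (Metric.ball (a • v) (a * ρ)) := by
            rw [Measure.addHaar_ball_mul_of_pos _ _ ha0]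
            simp [hb]
        _ = ∫⁻ y in Metric.ball (a • v) (a * ρ), 1 := by simp
        _ ≤ ∫⁻ y in Metric.ball (a • v) (a * ρ), ENNReal.ofReal
              (Real.exp (-2 * Real.pi * q.toReal * (inner ℝ t y + ψ y))) := by
            refine setLIntegral_mono' measurableSet_ball fun y hy => ?_
            rw [ENNReal.one_le_ofReal, Real.one_le_exp_iff]
            have h7 := (hmem y hy).2
            have h8 : 0 ≤ 2 * Real.pi * q.toReal := by positivity
            nlinarith
        _ ≤ I := lintegral_mono_set fun y hy => (hmem y hy).1
    have hIr : ∀ a : ℝ, 1 ≤ a → 2 * R / ‖v‖ ≤ a → a ≤ (I / b).toReal := by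
      intro a h1 h2
      have hbt : b ≠ ∞ := measure_ball_lt_top.ne
      have h3 : ENNReal.ofReal a ≤ I / b := by
        rw [ENNReal.le_div_iff_mul_le (Or.inl hb0) (Or.inl hbt)]
        exact key a h1 h2
      have h4 := ENNReal.toReal_mono (ENNReal.div_lt_top ht.ne hb0).ne h3
      rwa [ENNReal.toReal_ofReal (by linarith)] at h4
    set a := max 1 (max (2 * R / ‖v‖) ((I / b).toReal + 1)) with ha
    have := hIr a (le_max_left _ _) ((le_max_left _ _).trans (le_max_right _ _))
    have h9 : (I / b).toReal + 1 ≤ a := (le_max_right _ _).trans (le_max_right _ _)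
    linarith

end

/-! ### Fourier inversion for bounded continuous functions -/

section Inversion

variable {V : Type*} [NormedAddCommGroup V] [InnerProductSpace ℝ V] [FiniteDimensional ℝ V]
  [MeasurableSpace V] [BorelSpace V]

open scoped FourierTransform SchwartzMap

theorem continuous_fourierInv {g : V → ℂ} (hg : Integrable g) : Continuous (𝓕⁻ g) := by
  rw [Real.fourierInv_eq_fourier_comp_neg]
  exact VectorFourier.fourierIntegral_continuous Real.continuous_fourierChar
    (by exact continuous_inner) hg.comp_neg

theorem norm_fourierInv_le (g : V → ℂ) (x : V) : ‖𝓕⁻ g x‖ ≤ ∫ t, ‖g t‖ := by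
  rw [Real.fourierInv_eq_fourier_neg]
  exact VectorFourier.norm_fourierIntegral_le_integral_norm _ _ _ _ _

theorem integral_fourierInv_mul {g h : V → ℂ} (hg : Integrable g) (hh : Integrable h) :
    ∫ x, 𝓕⁻ g x * h x = ∫ t, g t * 𝓕⁻ h t := by
  have h1 := VectorFourier.integral_fourierIntegral_smul_eq_flip (L := innerₗ V) (μ := volume)
    (ν := volume) Real.continuous_fourierChar (by exact continuous_inner) hg hh.comp_neg
  rw [flip_innerₗ] at h1
  rw [Real.fourierInv_eq_fourier_comp_neg h]
  refine Eq.trans ?_ h1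
  rw [← integral_neg_eq_self]
  congr 1; ext x
  rw [Real.fourierInv_eq_fourier_neg, neg_neg]
  rfl

theorem fourier_comp_sub (ψ : V → ℂ) (τ x : V) :
    𝓕 (fun t => ψ (t - τ)) x =
      Complex.exp ((-2 * Real.pi * inner ℝ x τ : ℝ) * Complex.I) * 𝓕 ψ x := by
  rw [Real.fourier_eq', Real.fourier_eq', ← integral_const_mul,
    ← integral_add_right_eq_self _ τ]
  congr 1; ext t
  rw [add_sub_cancel_right, inner_add_left, smul_eq_mul, smul_eq_mul, ← mul_assoc,
    ← Complex.exp_add, real_inner_comm τ x]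
  congr 2
  push_cast; ring

/-- Modulating a bump function cancels the phase at x₀, so that the transform there is the positive
integral of the bump. -/
theorem exists_testFunction_fourier_ne_zero (x₀ : V) :
    ∃ ψ : V → ℂ, ContDiff ℝ (⊤ : ℕ∞) ψ ∧ HasCompactSupport ψ ∧ 𝓕 ψ x₀ ≠ 0 := by
  let χ : ContDiffBump (0 : V) := ⟨1, 2, by norm_num, by norm_num⟩
  refine ⟨fun t => (χ t : ℂ) * Complex.exp ((2 * Real.pi * inner ℝ t x₀ : ℝ) * Complex.I),
    ?_, ?_, ?_⟩
  · refine (Complex.ofRealCLM.contDiff.comp χ.contDiff).mul (Complex.contDiff_exp.comp ?_)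
    exact (Complex.ofRealCLM.contDiff.comp
      (contDiff_const.mul (contDiff_id.inner ℝ contDiff_const))).mul contDiff_const
  · exact (χ.hasCompactSupport.comp_left (g := fun r : ℝ => (r : ℂ)) Complex.ofReal_zero).mul_right
  · rw [Real.fourier_eq']
    have h1 : ∀ t : V, Complex.exp ((-2 * Real.pi * inner ℝ t x₀ : ℝ) * Complex.I) •
        ((χ t : ℂ) * Complex.exp ((2 * Real.pi * inner ℝ t x₀ : ℝ) * Complex.I)) = (χ t : ℂ) := by
      intro t
      rw [smul_eq_mul, mul_left_comm, ← Complex.exp_add]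
      have : ((-2 * Real.pi * inner ℝ t x₀ : ℝ) : ℂ) * Complex.I +
        ((2 * Real.pi * inner ℝ t x₀ : ℝ) : ℂ) * Complex.I = 0 := by push_cast; ring
      rw [this, Complex.exp_zero, mul_one]
    simp_rw [h1]
    rw [integral_complex_ofReal]
    exact_mod_cast (χ.integral_pos (μ := volume)).ne'

/-- A bounded continuous function whose distributional Fourier transform is an integrable
function is the inverse Fourier transform of that function. -/
theorem eq_fourierInv_of_forall_integral_mul_fourier_eq {g h : V → ℂ} {C : ℝ}
    (hc : Continuous h) (hb : ∀ x, ‖h x‖ ≤ C) (hg : Integrable g)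
    (H : ∀ ψ : V → ℂ, ContDiff ℝ (⊤ : ℕ∞) ψ → HasCompactSupport ψ →
      ∫ x, h x * 𝓕 ψ x = ∫ t, g t * ψ t) (x₀ : V) : h x₀ = 𝓕⁻ g x₀ := by
  obtain ⟨ψ, hψ, hψc, hψ0⟩ := exists_testFunction_fourier_ne_zero x₀
  have hFint : ∀ χ : V → ℂ, ContDiff ℝ (⊤ : ℕ∞) χ → HasCompactSupport χ →
      Integrable (𝓕 χ) := by
    intro χ h1 h2
    have := (𝓕 (h2.toSchwartzMap h1) : 𝓢(V, ℂ)).integrable (μ := volume)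
    rw [SchwartzMap.fourier_coe] at this
    exact this
  have hFcont : Continuous (𝓕 ψ) :=
    VectorFourier.fourierIntegral_continuous Real.continuous_fourierChar
      (by exact continuous_inner) (hψ.continuous.integrable_of_hasCompactSupport hψc)
  have hgc := continuous_fourierInv hg
  have hi1 : ∀ χ : V → ℂ, ContDiff ℝ (⊤ : ℕ∞) χ → HasCompactSupport χ →
      Integrable fun x => h x * 𝓕 χ x := fun χ h1 h2 =>
    (hFint χ h1 h2).bdd_mul hc.aestronglyMeasurable (ae_of_all _ hb)
  have hi2 : ∀ χ : V → ℂ, ContDiff ℝ (⊤ : ℕ∞) χ → HasCompactSupport χ →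
      Integrable fun x => 𝓕⁻ g x * 𝓕 χ x := fun χ h1 h2 =>
    (hFint χ h1 h2).bdd_mul hgc.aestronglyMeasurable (ae_of_all _ (norm_fourierInv_le g))
  -- The factor `𝓕 ψ` makes the difference integrable. Translating ψ by τ multiplies `𝓕 ψ` by a
  -- character, so the hypothesis for all translates says that `𝓕 D` vanishes identically.
  set D : V → ℂ := fun x => h x * 𝓕 ψ x - 𝓕⁻ g x * 𝓕 ψ x with hD
  have hDi : Integrable D := (hi1 ψ hψ hψc).sub (hi2 ψ hψ hψc)
  have hDc : Continuous D := (hc.mul hFcont).sub (hgc.mul hFcont)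
  have hFD : 𝓕 D = 0 := by
    ext τ
    set χ : V → ℂ := fun t => ψ (t - τ) with hχ
    have h1 : ContDiff ℝ (⊤ : ℕ∞) χ := hψ.comp (contDiff_id.sub contDiff_const)
    have h2 : HasCompactSupport χ := by
      have := hψc.comp_homeomorph (Homeomorph.subRight τ)
      exact this
    have h3 : ∀ x, Complex.exp ((-2 * Real.pi * inner ℝ x τ : ℝ) * Complex.I) • D x =
        h x * 𝓕 χ x - 𝓕⁻ g x * 𝓕 χ x := by
      intro x
      rw [hχ, fourier_comp_sub, hD, smul_eq_mul]
      ring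
    rw [Real.fourier_eq']
    simp_rw [h3]
    rw [integral_sub (hi1 χ h1 h2) (hi2 χ h1 h2), H χ h1 h2,
      integral_fourierInv_mul hg (hFint χ h1 h2),
      h1.continuous.fourierInv_fourier_eq (h1.continuous.integrable_of_hasCompactSupport h2)
        (hFint χ h1 h2), sub_self]
    rfl
  have hD0 := hDc.fourierInv_fourier_eq hDi (by rw [hFD]; exact integrable_zero _ _ _)
  have hDx : D x₀ = 0 := by
    rw [← hD0, hFD, Real.fourierInv_eq']
    simp
  simp only [hD, ← sub_mul] at hDx
  exact sub_eq_zero.1 ((mul_eq_zero.1 hDx).resolve_right hψ0)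

end Inversion

/-! ### Integrability of the density against exponentials, and recovery of F -/

section

theorem exists_exp_neg_mul_le (N : ℕ) {a : ℝ} (ha : 0 < a) :
    ∃ K : ℝ, 0 ≤ K ∧ ∀ r : ℝ, 0 ≤ r → Real.exp (-a * r) ≤ K * (1 + r) ^ (-(N : ℝ)) := by
  -- Dividing by N+1 rather than N covers N = 0 and still gives Nb ≤ a.
  set b := a / (N + 1) with hb
  have hb0 : 0 < b := by positivity
  set m := max 1 b⁻¹ with hm
  refine ⟨m ^ N, by positivity, fun r hr => ?_⟩
  have h1 : 1 + r ≤ m * Real.exp (b * r) := by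
    have h2 : 1 + b * r ≤ Real.exp (b * r) := by linarith [Real.add_one_le_exp (b * r)]
    have h3 : b⁻¹ * (b * r) = r := by field_simp
    calc 1 + r = 1 * 1 + b⁻¹ * (b * r) := by rw [h3, one_mul]
      _ ≤ m * 1 + m * (b * r) := by gcongr <;> simp [hm]
      _ = m * (1 + b * r) := by ring
      _ ≤ _ := by gcongr
  rw [Real.rpow_neg (by positivity), Real.rpow_natCast, ← div_eq_mul_inv,
    le_div_iff₀ (by positivity)]
  calc Real.exp (-a * r) * (1 + r) ^ N ≤ Real.exp (-a * r) * (m * Real.exp (b * r)) ^ N := by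
        gcongr
    _ = m ^ N * Real.exp (-a * r + N * (b * r)) := by
        rw [mul_pow, ← Real.exp_nat_mul, Real.exp_add]; ring
    _ ≤ m ^ N * 1 := by
        gcongr
        rw [Real.exp_le_one_iff]
        have : (N : ℝ) * b ≤ a := by
          rw [hb, mul_div_assoc', div_le_iff₀ (by positivity)]
          nlinarith
        nlinarith
    _ = m ^ N := mul_one _

variable {n : ℕ}

open scoped FourierTransform in
theorem integral_mul_laplaceKernel_cpoint (f : EuclideanSpace ℝ (Fin n) → ℂ)
    (x y : EuclideanSpace ℝ (Fin n)) :
    ∫ t, f t * laplaceKernel t (cpoint x y) =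
      𝓕⁻ (fun t => f t * (Real.exp (-2 * Real.pi * inner ℝ t y) : ℝ)) x := by
  rw [Real.fourierInv_eq']
  congr 1; ext t
  rw [laplaceKernel_cpoint, smul_eq_mul,
    show (2 * Real.pi * Complex.I * (inner ℝ t x : ℝ) : ℂ) =
      ((2 * Real.pi * inner ℝ t x : ℝ) : ℂ) * Complex.I by push_cast; ring]
  ring

/-- A square integrable density that lives where `t · v ≥ -A |v|` on the cone has integrable
products with the exponentials attached to the points of the cone. -/
theorem integrable_mul_exp_of_support {Γ : Set (EuclideanSpace ℝ (Fin n))}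
    (hΓ : IsOpen Γ) {A : ℝ} (hA : 0 ≤ A) {f : EuclideanSpace ℝ (Fin n) → ℂ} (hf : MemLp f 2 volume)
    (hsupp : ∀ t, f t ≠ 0 → ∀ v ∈ Γ, -A * ‖v‖ ≤ inner ℝ t v)
    {y : EuclideanSpace ℝ (Fin n)} (hy : y ∈ Γ) :
    Integrable fun t => f t * (Real.exp (-2 * Real.pi * inner ℝ t y) : ℝ) := by
  obtain ⟨r, hr, hsub⟩ := Metric.isOpen_iff.1 hΓ y hy
  set δ := r / 2 with hδ
  have hδ0 : 0 < δ := by positivity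
  -- N makes (1+|t|)^{-N} square integrable, so that its product with f is integrable by
  -- Cauchy–Schwarz.
  obtain ⟨N, hN⟩ := (inferInstance : (volume : Measure (EuclideanSpace ℝ (Fin
    n))).HasTemperateGrowth).exists_eLpNorm_lt_top 2
  obtain ⟨K, hK, hexp⟩ := exists_exp_neg_mul_le N (a := 2 * Real.pi * δ) (by positivity)
  set M := Real.exp (2 * Real.pi * (A * (‖y‖ + δ))) with hM
  have hmem : MemLp (fun t : EuclideanSpace ℝ (Fin n) => (1 + ‖t‖) ^ (-(N : ℝ))) 2 volume := by
    refine ⟨(Continuous.rpow_const (by fun_prop) fun t => Or.inl ?_).aestronglyMeasurable, hN⟩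
    positivity
  have hprod : Integrable (fun t => ‖f t‖ * (1 + ‖t‖) ^ (-(N : ℝ))) := hf.norm.integrable_mul hmem
  refine Integrable.mono' (hprod.const_mul (M * K)) ?_ (ae_of_all _ fun t => ?_)
  · exact hf.aestronglyMeasurable.mul (Continuous.aestronglyMeasurable (by fun_prop))
  rw [norm_mul, Complex.norm_real, Real.norm_of_nonneg (Real.exp_nonneg _)]
  by_cases ht : f t = 0
  · simp [ht]
  -- The support condition is tested at y - δt/|t|, which is still in Γ; the gain δ|t| gives
  -- exponential decay.
  have hinner : δ * ‖t‖ - A * (‖y‖ + δ) ≤ inner ℝ t y := by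
    rcases eq_or_ne t 0 with rfl | ht0
    · simp only [norm_zero, mul_zero, inner_zero_left]
      have : 0 ≤ A * (‖y‖ + δ) := by positivity
      linarith
    have htn : 0 < ‖t‖ := norm_pos_iff.2 ht0
    set u := (δ / ‖t‖) • t with hu
    have hun : ‖u‖ = δ := by
      rw [hu, norm_smul, Real.norm_of_nonneg (by positivity), div_mul_cancel₀ _ htn.ne']
    have h1 := hsupp t ht (y - u) (hsub (by
      rw [Metric.mem_ball, dist_self_sub_left, hun, hδ]; linarith))
    rw [inner_sub_right, hu, real_inner_smul_right, real_inner_self_eq_norm_sq, ← hu] at h1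
    have h2 : δ / ‖t‖ * ‖t‖ ^ 2 = δ * ‖t‖ := by field_simp
    have h3 : ‖y - u‖ ≤ ‖y‖ + δ := by rw [← hun]; exact norm_sub_le _ _
    nlinarith
  have hfin : Real.exp (-2 * Real.pi * inner ℝ t y) ≤ M * K * (1 + ‖t‖) ^ (-(N : ℝ)) := by
    calc Real.exp (-2 * Real.pi * inner ℝ t y)
        ≤ Real.exp (2 * Real.pi * (A * (‖y‖ + δ)) + -(2 * Real.pi * δ) * ‖t‖) := by
          gcongr
          nlinarith [Real.pi_pos]
      _ = M * Real.exp (-(2 * Real.pi * δ) * ‖t‖) := Real.exp_add _ _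
      _ ≤ M * (K * (1 + ‖t‖) ^ (-(N : ℝ))) := by gcongr; exact hexp _ (norm_nonneg t)
      _ = _ := by ring
  calc _ ≤ ‖f t‖ * (M * K * (1 + ‖t‖) ^ (-(N : ℝ))) := by gcongr
    _ = _ := by ring

-- Testing with ψ(t) e^{-2πt·y} cancels the weight in Φ. The pairing identity then says that the
-- slice of F has distributional inverse transform data f(t) e^{-2πt·y}, and inversion applies.
open scoped FourierTransform in
theorem eq_integral_mul_laplaceKernel {B : Set (EuclideanSpace ℝ (Fin n))}
    {F : EuclideanSpace ℂ (Fin n) → ℂ} (hF : DifferentiableOn ℂ F (tube B))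
    {y : EuclideanSpace ℝ (Fin n)} (hy : y ∈ B) {C : ℝ} (hb : ∀ x, ‖F (cpoint x y)‖ ≤ C)
    {f : EuclideanSpace ℝ (Fin n) → ℂ}
    (hf : ∀ φ : EuclideanSpace ℝ (Fin n) → ℂ, ContDiff ℝ (⊤ : ℕ∞) φ → HasCompactSupport φ →
      ∫ x, F (cpoint x y) * fourierLaplace φ (cpoint x y) = ∫ t, f t * φ t)
    (hint : Integrable fun t => f t * (Real.exp (-2 * Real.pi * inner ℝ t y) : ℝ))
    (x : EuclideanSpace ℝ (Fin n)) :
    F (cpoint x y) = ∫ t, f t * laplaceKernel t (cpoint x y) := by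
  rw [integral_mul_laplaceKernel_cpoint]
  refine eq_fourierInv_of_forall_integral_mul_fourier_eq (h := fun x => F (cpoint x y))
    (continuous_slice hF hy) hb hint (fun ψ hψ hψc => ?_) x
  have h := hf (fun t => ψ t * (Real.exp (-2 * Real.pi * inner ℝ t y) : ℝ))
    (hψ.mul (contDiff_exp_inner _ y)) hψc.mul_right
  simp only [fourierLaplace_cpoint] at h
  have h1 : ∀ t, ψ t * ((Real.exp (-2 * Real.pi * inner ℝ t y) : ℝ) : ℂ) *
      ((Real.exp (2 * Real.pi * inner ℝ t y) : ℝ) : ℂ) = ψ t := by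
    intro t
    rw [mul_assoc, ← Complex.ofReal_mul, ← Real.exp_add]
    have : -2 * Real.pi * inner ℝ t y + 2 * Real.pi * inner ℝ t y = 0 := by ring
    rw [this, Real.exp_zero, Complex.ofReal_one, mul_one]
  simp_rw [h1] at h
  rw [h]
  congr 1; ext t; ring

end

/-! ### Slice norms and the support of the density -/

section

variable {n : ℕ} {Γ : Set (EuclideanSpace ℝ (Fin n))} {p s : ℝ≥0∞}
  {ψ : EuclideanSpace ℝ (Fin n) → ℝ} {F : EuclideanSpace ℂ (Fin n) → ℂ}

/-- The weighted `L^p` norm of a horizontal slice. -/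
noncomputable def sliceNorm (p : ℝ≥0∞) (ψ : EuclideanSpace ℝ (Fin n) → ℝ)
    (F : EuclideanSpace ℂ (Fin n) → ℂ) (y : EuclideanSpace ℝ (Fin n)) : ℝ≥0∞ :=
  ENNReal.ofReal (Real.exp (-2 * Real.pi * ψ y)) * eLpNorm (fun x => F (cpoint x y)) p volume

theorem ofReal_exp_mul_ofReal_exp_neg (a : ℝ) :
    ENNReal.ofReal (Real.exp a) * ENNReal.ofReal (Real.exp (-a)) = 1 := by
  rw [← ENNReal.ofReal_mul (Real.exp_nonneg _), ← Real.exp_add, add_neg_cancel, Real.exp_zero,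
    ENNReal.ofReal_one]

theorem eLpNorm_slice_eq (p : ℝ≥0∞) (ψ : EuclideanSpace ℝ (Fin n) → ℝ)
    (F : EuclideanSpace ℂ (Fin n) → ℂ) (y : EuclideanSpace ℝ (Fin n)) :
    eLpNorm (fun x => F (cpoint x y)) p volume =
      ENNReal.ofReal (Real.exp (2 * Real.pi * ψ y)) * sliceNorm p ψ F y := by
  have := ofReal_exp_mul_ofReal_exp_neg (2 * Real.pi * ψ y)
  rw [sliceNorm, ← mul_assoc, show -2 * Real.pi * ψ y = -(2 * Real.pi * ψ y) by ring, this,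
    one_mul]

theorem exists_sliceNorm_le (hp : 2 < p) (hq : s * p = ∞)
    (hF : weightedNorm p s Γ ψ F < ∞) :
    ∃ M : ℝ≥0∞, M ≠ ∞ ∧ ∀ y ∈ Γ, sliceNorm p ψ F y ≤ M := by
  refine ⟨_, hF.ne, fun y hy => ?_⟩
  unfold weightedNorm
  split_ifs with h1 h2
  · subst h1
    have hbound : ∀ x, ENNReal.ofReal (Real.exp (-2 * Real.pi * ψ y)) * ‖F (cpoint x y)‖ₑ ≤
        ⨆ y ∈ Γ, ⨆ x : EuclideanSpace ℝ (Fin n),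
          ENNReal.ofReal (Real.exp (-2 * Real.pi * ψ y)) * ‖F (cpoint x y)‖ₑ := fun x =>
      le_iSup₂_of_le y hy (le_iSup_of_le x le_rfl)
    rw [sliceNorm, eLpNorm_exponent_top, eLpNormEssSup,
      ← ENNReal.essSup_const_mul]
    exact essSup_le_of_ae_le _ (ae_of_all _ hbound)
  · refine le_iSup₂_of_le y hy ?_
    rw [sliceNorm, eLpNorm_eq_lintegral_rpow_enorm_toReal (by positivity) h1]
  · rcases ENNReal.mul_eq_top.1 hq with h | h
    · exact absurd h.2 h1
    · exact absurd h.1 h2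

/-- The inner integral is the p-th power of the slice norm, so the mixed norm is an L^{sp} norm in y
alone; this is why only sp enters the support set. -/
theorem lintegral_sliceNorm_lt_top (hp : 2 < p) (hs : 0 < s) (hq : s * p ≠ ∞)
    (hF : weightedNorm p s Γ ψ F < ∞) :
    ∫⁻ y in Γ, sliceNorm p ψ F y ^ (s * p).toReal < ∞ := by
  have hp0 : p ≠ 0 := by positivity
  have hpt : p ≠ ∞ := by rintro rfl; exact hq (ENNReal.mul_top hs.ne')
  have hst : s ≠ ∞ := by rintro rfl; exact hq (ENNReal.top_mul hp0)
  have hpr : 0 < p.toReal := ENNReal.toReal_pos hp0 hpt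
  have hsr : 0 < s.toReal := ENNReal.toReal_pos hs.ne' hst
  rw [weightedNorm, if_neg hpt, if_neg hst, ENNReal.rpow_lt_top_iff_of_pos (by positivity)] at hF
  refine lt_of_le_of_lt (lintegral_mono fun y => le_of_eq ?_) hF
  simp_rw [ENNReal.mul_rpow_of_nonneg _ _ hpr.le]
  rw [lintegral_mul_const' _ _ (ENNReal.rpow_ne_top_of_nonneg hpr.le ENNReal.ofReal_ne_top),
    sliceNorm, eLpNorm_eq_lintegral_rpow_enorm_toReal hp0 hpt, ENNReal.toReal_mul,
    mul_comm s.toReal, ENNReal.rpow_mul, ENNReal.mul_rpow_of_nonneg _ _ hpr.le,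
    ← ENNReal.rpow_mul, one_div_mul_cancel hpr.ne', ENNReal.rpow_one, mul_comm]

theorem forall_exists_bound (hΓ : IsOpen Γ) (hψ : ContinuousOn ψ Γ) (hp : 2 < p) (hs : 0 < s)
    (hF : F ∈ weightedBergman p s Γ ψ) :
    ∀ y ∈ Γ, ∃ r > 0, ∃ C, ∀ y' ∈ Metric.ball y r, y' ∈ Γ → ∀ x, ‖F (cpoint x y')‖ ≤ C := by
  intro y hy
  obtain ⟨r₀, hr₀, hsub⟩ := Metric.isOpen_iff.1 hΓ y hy
  set r := r₀ / 2 with hr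
  have hr0 : 0 < r := by positivity
  have hcb : Metric.closedBall y r ⊆ Γ :=
    (Metric.closedBall_subset_ball (by rw [hr]; linarith)).trans hsub
  have hball : Metric.ball y r ⊆ Γ := Metric.ball_subset_closedBall.trans hcb
  obtain ⟨m, hm⟩ := (isCompact_closedBall y r).exists_bound_of_continuousOn (hψ.mono hcb)
  set W := ENNReal.ofReal (Real.exp (2 * Real.pi * m)) with hW
  have hle : ∀ y' ∈ Metric.ball y r, eLpNorm (fun x => F (cpoint x y')) p volume ≤
      W * sliceNorm p ψ F y' := by
    intro y' hy'
    rw [eLpNorm_slice_eq p ψ F y', hW]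
    gcongr
    exact (le_abs_self _).trans (hm y' (Metric.ball_subset_closedBall hy'))
  have hp1 : 1 ≤ p := one_le_two.trans hp.le
  by_cases hq : s * p = ∞
  · obtain ⟨M, hM, hMb⟩ := exists_sliceNorm_le hp hq hF.2
    refine exists_local_bound hΓ hF.1 hp1 one_pos le_rfl hy hr0 ?_
    refine lt_of_le_of_lt (setLIntegral_mono' measurableSet_ball (g := fun _ => W * M)
      fun y' hy' => ?_) ?_
    · rw [ENNReal.rpow_one]
      exact (hle y' hy').trans (by gcongr; exact hMb y' (hball hy'))
    · rw [setLIntegral_const]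
      exact ENNReal.mul_lt_top (ENNReal.mul_lt_top ENNReal.ofReal_lt_top hM.lt_top)
        measure_ball_lt_top
  · set q := (s * p).toReal with hqd
    have hq0 : 0 < q := ENNReal.toReal_pos (mul_ne_zero hs.ne' (by positivity)) hq
    have hI := lintegral_sliceNorm_lt_top hp hs hq hF.2
    -- The local bound needs an exponent at most 1, while sp may exceed 1; u^{min(1,q)} ≤ 1 + u^q on
    -- a ball of finite measure bridges the two.
    refine exists_local_bound hΓ hF.1 hp1 (q := min 1 q) (by positivity) (min_le_left _ _) hy
      hr0 ?_
    refine lt_of_le_of_lt (setLIntegral_mono' measurableSet_ball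
      (g := fun y' => 1 + W ^ q * sliceNorm p ψ F y' ^ q) fun y' hy' => ?_) ?_
    · rw [← ENNReal.mul_rpow_of_nonneg _ _ hq0.le]
      refine (ENNReal.rpow_le_rpow (hle y' hy') (by positivity)).trans ?_
      rcases le_total (W * sliceNorm p ψ F y') 1 with h | h
      · exact (ENNReal.rpow_le_one h (by positivity)).trans le_self_add
      · exact (ENNReal.rpow_le_rpow_of_exponent_le h (min_le_right _ _)).trans le_add_self
    · rw [lintegral_add_left measurable_const, setLIntegral_const, one_mul,
        lintegral_const_mul' _ _ (ENNReal.rpow_ne_top_of_nonneg hq0.le ENNReal.ofReal_ne_top)]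
      refine ENNReal.add_lt_top.2 ⟨measure_ball_lt_top, ENNReal.mul_lt_top
        (ENNReal.rpow_lt_top_of_nonneg hq0.le ENNReal.ofReal_ne_top) ?_⟩
      exact lt_of_le_of_lt (lintegral_mono_set hball) hI

/-- A frequency `t` such that `|∫ F Φ|` is nonzero for some test function `φ` with
`τ · y ≤ t · y` for `τ` in its support belongs to the support set. -/
theorem mem_supportSet_of_integral_ne_zero (hΓ : MeasurableSet Γ)
    (hp : 2 < p) (hs : 0 < s) (hF : F ∈ weightedBergman p s Γ ψ)
    {φ : EuclideanSpace ℝ (Fin n) → ℂ} (hφ : ContDiff ℝ (⊤ : ℕ∞) φ) (hc : HasCompactSupport φ)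
    {c : ℂ} (hc0 : c ≠ 0)
    (hpair : ∀ y ∈ Γ, ∫ x, F (cpoint x y) * fourierLaplace φ (cpoint x y) = c)
    {t : EuclideanSpace ℝ (Fin n)}
    (ht : ∀ y ∈ Γ, ∀ τ ∈ tsupport φ, inner ℝ τ y ≤ inner ℝ t y) :
    t ∈ supportSet (s * p) Γ ψ := by
  have hp1 : 1 ≤ p := one_le_two.trans hp.le
  have hconj : ENNReal.HolderConjugate p p.conjExponent := .conjExponent hp1
  obtain ⟨N, hN⟩ := (inferInstance : (volume : Measure (EuclideanSpace ℝ (Fin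
    n))).HasTemperateGrowth).exists_eLpNorm_lt_top p.conjExponent
  obtain ⟨C, hC, hdec⟩ := norm_fourierLaplace_decay N hφ hc
  set Z := eLpNorm (fun x : EuclideanSpace ℝ (Fin n) => (1 + ‖x‖) ^ (-(N : ℝ)))
    p.conjExponent volume with hZ
  set D : ℝ≥0∞ := ENNReal.ofReal C * Z / ‖c‖ₑ with hD
  have hce : ‖c‖ₑ ≠ 0 := by simpa using hc0
  have hDfin : D ≠ ∞ := (ENNReal.div_lt_top
    (ENNReal.mul_lt_top ENNReal.ofReal_lt_top hN).ne hce).ne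
  -- Hölder gives |c| ≤ ‖F(·+iy)‖_p ‖Φ(·+iy)‖_{p'}, and the domination by t bounds the last factor
  -- by C e^{2πt·y} Z. Solving for the exponential leaves a constant `D` that does not depend on y.
  have key : ∀ y ∈ Γ, ENNReal.ofReal (Real.exp (-(2 * Real.pi * (inner ℝ t y + ψ y)))) ≤
      D * sliceNorm p ψ F y := by
    intro y hy
    set X := ENNReal.ofReal (Real.exp (2 * Real.pi * inner ℝ t y)) with hX
    have h1 := enorm_integral_mul_le (μ := volume) (continuous_slice hF.1 hy).aestronglyMeasurable
      (continuous_fourierLaplace_slice hφ.continuous hc y).aestronglyMeasurable p p.conjExponent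
    rw [hpair y hy] at h1
    have h2 : eLpNorm (fun x => fourierLaplace φ (cpoint x y)) p.conjExponent volume ≤
        ENNReal.ofReal C * X * Z := by
      rw [hX, ← ENNReal.ofReal_mul hC]
      refine eLpNorm_le_mul_eLpNorm_of_ae_le_mul (ae_of_all _ fun x => ?_) _
      rw [Real.norm_of_nonneg (by positivity)]
      exact hdec x y _ (ht y hy)
    have h3 := h1.trans (mul_le_mul' le_rfl h2)
    rw [eLpNorm_slice_eq p ψ F y] at h3
    set Y := ENNReal.ofReal (Real.exp (2 * Real.pi * ψ y)) with hY
    have h4 : Y * X * ENNReal.ofReal (Real.exp (-(2 * Real.pi * (inner ℝ t y + ψ y)))) = 1 := by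
      rw [hX, hY, ← ENNReal.ofReal_mul (Real.exp_nonneg _), ← Real.exp_add]
      convert ofReal_exp_mul_ofReal_exp_neg (2 * Real.pi * (inner ℝ t y + ψ y)) using 4
      ring
    set G := ENNReal.ofReal (Real.exp (-(2 * Real.pi * (inner ℝ t y + ψ y)))) with hG
    have h5 : G * ‖c‖ₑ ≤ sliceNorm p ψ F y * (ENNReal.ofReal C * Z) := by
      calc G * ‖c‖ₑ ≤ G * (Y * sliceNorm p ψ F y * (ENNReal.ofReal C * X * Z)) := by gcongr
        _ = (Y * X * G) * (sliceNorm p ψ F y * (ENNReal.ofReal C * Z)) := by ring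
        _ = _ := by rw [h4, one_mul]
    have h6 : G ≤ sliceNorm p ψ F y * (ENNReal.ofReal C * Z) / ‖c‖ₑ :=
      (ENNReal.le_div_iff_mul_le (Or.inl hce) (Or.inl enorm_ne_top)).2 h5
    refine h6.trans (le_of_eq ?_)
    rw [hD, div_eq_mul_inv, div_eq_mul_inv]; ring
  simp only [supportSet, Set.mem_ofPred_eq]
  split_ifs with hq
  · obtain ⟨M, hM, hMb⟩ := exists_sliceNorm_le hp hq hF.2
    refine ⟨-((D * M).toReal / (2 * Real.pi)), ?_⟩
    rintro _ ⟨y, hy, rfl⟩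
    have h1 := ENNReal.toReal_mono (ENNReal.mul_ne_top hDfin hM)
      ((key y hy).trans (mul_le_mul' le_rfl (hMb y hy)))
    rw [ENNReal.toReal_ofReal (Real.exp_nonneg _)] at h1
    have h2 := Real.add_one_le_exp (-(2 * Real.pi * (inner ℝ t y + ψ y)))
    simp only
    rw [real_inner_comm, neg_le, le_div_iff₀ Real.two_pi_pos]
    linarith
  · set q := (s * p).toReal with hqd
    have hq0 : 0 < q := ENNReal.toReal_pos (mul_ne_zero hs.ne' (by positivity)) hq
    have hI := lintegral_sliceNorm_lt_top hp hs hq hF.2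
    refine lt_of_le_of_lt (setLIntegral_mono' hΓ
      (g := fun y => D ^ q * sliceNorm p ψ F y ^ q) fun y hy => ?_) ?_
    · rw [← ENNReal.mul_rpow_of_nonneg _ _ hq0.le]
      refine le_trans (le_of_eq ?_) (ENNReal.rpow_le_rpow (key y hy) hq0.le)
      rw [ENNReal.ofReal_rpow_of_pos (Real.exp_pos _), ← Real.exp_mul]
      congr 2; ring
    · rw [lintegral_const_mul' _ _ (ENNReal.rpow_ne_top_of_nonneg hq0.le hDfin)]
      exact ENNReal.mul_lt_top (ENNReal.rpow_lt_top_of_nonneg hq0.le hDfin) hI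

/-- The density of a function of `A^{p,s}` vanishes almost everywhere off the support set. -/
theorem ae_mem_supportSet_of_ne_zero (hΓ : IsRegularOpenConvexCone Γ) (hψ : ContinuousOn ψ Γ)
    (hp : 2 < p) (hs : 0 < s) (hF : F ∈ weightedBergman p s Γ ψ)
    {f : EuclideanSpace ℝ (Fin n) → ℂ} (hf : MemLp f 2 volume)
    (hpair : ∀ φ : EuclideanSpace ℝ (Fin n) → ℂ, ContDiff ℝ (⊤ : ℕ∞) φ → HasCompactSupport φ →
      ∀ y ∈ Γ, ∫ x, F (cpoint x y) * fourierLaplace φ (cpoint x y) = ∫ t, f t * φ t) :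
    ∀ᵐ t, f t ≠ 0 → t ∈ supportSet (s * p) Γ ψ := by
  set U := supportSet (s * p) Γ ψ with hU
  obtain ⟨e, c, hc, hcoer⟩ := hΓ.exists_coercive
  have hloc : ∀ t₀ ∈ (closure U)ᶜ, ∃ ε > 0, ∀ᵐ t, t ∈ Metric.ball t₀ ε → f t = 0 := by
    intro t₀ ht₀
    obtain ⟨r, hr, hsub⟩ := Metric.isOpen_iff.1 isClosed_closure.isOpen_compl t₀ ht₀
    -- The point t₀ + (ε/c)e dominates the ball of radius ε about t₀ on the whole cone, by
    -- coercivity of e. This ε keeps it within r of t₀, hence outside the closure of U, so every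
    -- pairing on that ball must vanish.
    set ε := c * r / (‖e‖ + 1) with hε
    have hε0 : 0 < ε := by positivity
    refine ⟨ε, hε0, Metric.isOpen_ball.ae_eq_zero_of_integral_contDiff_smul_eq_zero
      ((hf.locallyIntegrable one_le_two).locallyIntegrableOn _) fun g hg hgc hgs => ?_⟩
    set φ : EuclideanSpace ℝ (Fin n) → ℂ := fun t => (g t : ℂ) with hφ
    have h1 : ContDiff ℝ (⊤ : ℕ∞) φ := Complex.ofRealCLM.contDiff.comp hg
    have h2 : HasCompactSupport φ := hgc.comp_left (g := fun r : ℝ => (r : ℂ)) Complex.ofReal_zero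
    have h3 : tsupport φ ⊆ tsupport g := by
      refine closure_mono fun t ht => ?_
      simpa [hφ] using ht
    have h4 : ∫ t, g t • f t = ∫ t, f t * φ t := by
      congr 1; ext t
      rw [Complex.real_smul, mul_comm]
    rw [h4]
    by_contra hne
    have hmem := mem_supportSet_of_integral_ne_zero hΓ.isOpen.measurableSet hp hs hF h1 h2 hne
      (fun y hy => hpair φ h1 h2 y hy) (t := t₀ + (ε / c) • e) (fun y hy τ hτ => by
        have h5 : ‖τ - t₀‖ ≤ ε := by
          rw [← dist_eq_norm]; exact le_of_lt (hgs (h3 hτ))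
        have h6 : inner ℝ (τ - t₀) y ≤ ε * ‖y‖ :=
          (real_inner_le_norm _ _).trans (by gcongr)
        have h7 : ε * ‖y‖ ≤ ε / c * inner ℝ e y := by
          have := mul_le_mul_of_nonneg_left (hcoer y hy) (by positivity : 0 ≤ ε / c)
          rwa [← mul_assoc, div_mul_cancel₀ _ hc.ne'] at this
        rw [inner_sub_left] at h6
        rw [inner_add_left, real_inner_smul_left]
        linarith)
    refine hsub ?_ (subset_closure hmem)
    rw [Metric.mem_ball, dist_self_add_left, norm_smul, Real.norm_of_nonneg (by positivity), hε]
    have h8 : c * r / (‖e‖ + 1) / c * ‖e‖ = r * (‖e‖ / (‖e‖ + 1)) := by field_simp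
    rw [h8]
    have h9 : ‖e‖ / (‖e‖ + 1) < 1 := by
      rw [div_lt_one (by positivity)]; linarith
    exact mul_lt_of_lt_one_right hr h9
  have hout : volume {t | t ∈ (closure U)ᶜ ∧ f t ≠ 0} = 0 := by
    refine measure_null_of_locally_null _ fun t₀ ht₀ => ?_
    obtain ⟨ε, hε, hae⟩ := hloc t₀ ht₀.1
    refine ⟨{t | ¬ (t ∈ Metric.ball t₀ ε → f t = 0)}, ?_, hae⟩
    rw [mem_nhdsWithin]
    refine ⟨Metric.ball t₀ ε, Metric.isOpen_ball, Metric.mem_ball_self hε, ?_⟩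
    rintro t ⟨h1, h2⟩
    simp only [Set.mem_ofPred_eq, Classical.not_imp]
    exact ⟨h1, h2.2⟩
  have hfr : volume (frontier U) = 0 :=
    (convex_supportSet hΓ.isOpen.measurableSet hψ _).addHaar_frontier volume
  have h1 : ∀ᵐ t, ¬ (t ∈ (closure U)ᶜ ∧ f t ≠ 0) := measure_eq_zero_iff_ae_notMem.1 hout
  have h2 : ∀ᵐ t, t ∉ frontier U := measure_eq_zero_iff_ae_notMem.1 hfr
  filter_upwards [h1, h2] with t h3 h4 h5
  by_contra h6
  have h7 : t ∈ closure U := by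
    by_contra h8
    exact h3 ⟨h8, h5⟩
  exact h4 ⟨h7, fun h => h6 (interior_subset h)⟩

end

end TubeBergman

theorem theorem3 (n : ℕ) (p s : ℝ≥0∞) (hp : 2 < p) (hs : 0 < s)
    (Γ : Set (EuclideanSpace ℝ (Fin n))) (hΓ : TubeBergman.IsRegularOpenConvexCone Γ)
    (ψ : EuclideanSpace ℝ (Fin n) → ℝ) (hψ : ContinuousOn ψ Γ)
    (hR : TubeBergman.growthRate Γ ψ < ⊤)
    (F : EuclideanSpace ℂ (Fin n) → ℂ) (hF : F ∈ TubeBergman.weightedBergman p s Γ ψ)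
    (hlim : liminf (fun y => ∫⁻ x : EuclideanSpace ℝ (Fin n),
      ‖F (TubeBergman.cpoint x y)‖ₑ ^ 2) (𝓝[Γ] 0) < ∞) :
    ∃ f : EuclideanSpace ℝ (Fin n) → ℂ,
      MemLp f 2 volume ∧
      Function.support f ⊆ TubeBergman.supportSet (s * p) Γ ψ ∧
      ∀ z ∈ TubeBergman.tube Γ,
        Integrable (fun t => f t * TubeBergman.laplaceKernel t z) volume ∧
        F z = ∫ t, f t * TubeBergman.laplaceKernel t z := by
  open TubeBergman in
  have hbd := forall_exists_bound hΓ.isOpen hψ hp hs hF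
  obtain ⟨g, hg, hpair⟩ := exists_density hΓ.isOpen hΓ.convex hF.1 hbd hlim
  obtain ⟨A, R, hA, hAR⟩ := exists_linear_bound_of_growthRate_lt_top hR
  -- The density vanishes off the support set only almost everywhere; cutting it off makes this hold
  -- at every point without changing any integral.
  set f := (supportSet (s * p) Γ ψ).indicator g with hf
  have hae : g =ᵐ[volume] f := by
    filter_upwards [ae_mem_supportSet_of_ne_zero hΓ hψ hp hs hF hg hpair] with t ht
    by_cases hU : t ∈ supportSet (s * p) Γ ψ
    · exact (Set.indicator_of_mem hU g).symm
    · rw [hf, Set.indicator_of_notMem hU]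
      by_contra h
      exact hU (ht h)
  have hf2 : MemLp f 2 volume := (memLp_congr_ae hae).1 hg
  have hsupp : Function.support f ⊆ supportSet (s * p) Γ ψ := Set.support_indicator_subset
  refine ⟨f, hf2, hsupp, ?_⟩
  rintro _ ⟨x, y, hy, rfl⟩
  have hint := integrable_mul_exp_of_support hΓ.isOpen hA hf2
    (fun t ht v hv => neg_mul_norm_le_inner_of_mem_supportSet hΓ hAR (hsupp ht) hv) hy
  constructor
  · refine hint.mono (hf2.aestronglyMeasurable.mul (Continuous.aestronglyMeasurable
      (continuous_laplaceKernel.comp (continuous_id.prodMk continuous_const))))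
      (ae_of_all _ fun t => ?_)
    rw [norm_mul, norm_mul, norm_laplaceKernel, Complex.norm_real,
      Real.norm_of_nonneg (Real.exp_nonneg _)]
  · obtain ⟨r, hr, C, hC⟩ := hbd y hy
    refine eq_integral_mul_laplaceKernel hF.1 hy (hC y (Metric.mem_ball_self hr) hy)
      (fun φ hφ hc => (hpair φ hφ hc y hy).trans ?_) hint x
    refine integral_congr_ae ?_
    filter_upwards [hae] with t ht
    rw [ht]
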